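/- Let $V=\{1,\dots,n\}$, let $G_0=(V,E_0)$ be a deterministic graph without self-loops, $E_0\subset V\times V$ (an unoriented edge is identified with the two oriented edges in both directions), and let $E_{\rm open}$ be the random set that contains every oriented edge $i\to j\notin E_0$, $i\ne j$, independently with probability $p_{\rm open}=p_{\rm open}(n)$. For $t\ge 0$ let $$E_{t+1}=E_t\cup\{\,i\to j\in E_{\rm open}:\ i\to k\in E_t\text{ and }k\to j\in E_t\text{ for some }k\in V\,\},\qquad E_\infty=\bigcup_{t\ge0}E_t .$$ The length of an edge $i\to j$ is the number of edges of a shortest oriented path from $i$ to $j$ in $G_0$ ($\infty$ if there is none). An event (depending on $n$) holds a.a.s. if its probability tends to $1$ as $n\to\infty$. **Theorem.** Fix a constant $\alpha>0$ and an integer $D\ge0$. There exist constants $c,C\in(0,\infty)$, depending only on $D$ and $\alpha$, such that for all sequences of connected unoriented graphs $G_0$ with all degrees at most $D$: 1. if $p_{\rm open}<c/\sqrt{\log n}$ for all large $n$, then a.a.s. no edge of length exceeding $\alpha\log n$ belongs to $E_\infty$; 2. if $p_{\rm open}>C\log\log n/\sqrt{\log n}$ for all large $n$, then a.a.s. saturation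 occurs, i.e. $E_\infty=E_0\cup E_{\rm open}$. Moreover, the following stronger forms hold. - (Stronger form of 1.) For all $\alpha>0$ and $D$ there is $c=c(\alpha,D)>0$ such that, for all sequences of oriented graphs $G_0$, connected or not, with all in-degrees and out-degrees at most $D$, if $p_{\rm open}<c/\sqrt{\log n}$ for all large $n$, then $$\mathbb P(\text{some edge of length at least }\alpha\log n\text{ belongs to }E_\infty)\to0\quad\text{as }n\to\infty .$$ - (Stronger form of 2.) For every $C>4$ and all sequences of connected unoriented graphs $G_0$ (with no bound on the degrees), if $p_{\rm open}\ge C\log\log n/\sqrt{\log n}$ for all large $n$, then a.a.s. $E_\infty=E_0\cup E_{\rm open}$. -/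

import Mathlib

open MeasureTheory ProbabilityTheory Filter Topology
open scoped ENNReal unitInterval

namespace TransClosure

/-- The edge set of an unoriented graph: an unoriented edge is identified with the two
oriented edges `(i, j)` and `(j, i)`. -/
def edges {V : Type*} (G : SimpleGraph V) : Set (V × V) :=
  {e | G.Adj e.1 e.2}

/-- The occupied edges `E_t` at time `t`, started from `E0`: an open edge `(i, j)` becomes
occupied at time `t + 1` if `(i, k)` and `(k, j)` are occupied at time `t` for some `k`. -/
def occupied {V : Type*} (E0 Eopen : Set (V × V)) : ℕ → Set (V × V)
  | 0 => E0
  | t + 1 => occupied E0 Eopen t ∪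
      {e | e ∈ Eopen ∧ ∃ k, (e.1, k) ∈ occupied E0 Eopen t ∧ (k, e.2) ∈ occupied E0 Eopen t}

/-- The eventually occupied edges `E_∞ = ⋃ t, E_t`. -/
def eventuallyOccupied {V : Type*} (E0 Eopen : Set (V × V)) : Set (V × V) :=
  ⋃ t, occupied E0 Eopen t

/-- There is an oriented walk with exactly `m` edges, all in `E0`, from `i` to `j`. -/
def WalkIn {V : Type*} (E0 : Set (V × V)) : ℕ → V → V → Prop
  | 0, i, j => i = j
  | m + 1, i, j => ∃ k, (i, k) ∈ E0 ∧ WalkIn E0 m k j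

/-- The length of an edge `(i, j)`: the number of edges of a shortest oriented path from `i` to
`j` in the initial graph (`⊤` if there is none). A shortest walk is automatically a path. -/
noncomputable def length {V : Type*} (E0 : Set (V × V)) (e : V × V) : ℕ∞ :=
  ⨅ (m : ℕ) (_ : WalkIn E0 m e.1 e.2), (m : ℕ∞)

/-- The law of the set of open edges of the oriented Erdős–Rényi graph of density `p`: every
oriented edge that is neither initially occupied nor a self-loop is open with probability `p`,
independently of the others; the remaining ones are never open. -/
noncomputable def openLaw {V : Type*} (E0 : Set (V × V)) (p : I) : Measure (Set (V × V)) :=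
  setBernoulli {e | e.1 ≠ e.2 ∧ e ∉ E0} p

/-- Probability of saturation, `E_∞ = E_0 ∪ E_open`. -/
noncomputable def probSaturated {V : Type*} (E0 : Set (V × V)) (p : I) : ℝ≥0∞ :=
  openLaw E0 p {Eopen | eventuallyOccupied E0 Eopen = E0 ∪ Eopen}

end TransClosure

/-!
**Subcritical regime.** An occupied edge has a binary witness tree, and a long one can be
truncated so that its vertices form a connected set `S` with between `L` and `2L` elements in
which every vertex lies on an initial edge reinforced by the two open edges of a triangle over
`S`. Degrees being bounded, a fixed fraction of `L` of these edges are vertex-disjoint and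
reinforced in the same direction. For given edges these reinforcements are independent, and each
has probability at most `D p + 2 L p²`. As there are only exponentially many (in `L`) choices of
`S` and of the edges, a union bound with `L` of order `log n` concludes.

**Supercritical regime.** Split `p` into two independent rounds `p₁` and `q`. Among many disjoint
connected sets of about `log n / log log n` vertices, one contains a star that is fully open in
both directions in the first round, and such a set is saturated (a vertex of large degree provides
a star for free). In the second round a saturated set of `t + 1` vertices absorbs an adjacent
vertex up to a probability that is summable in `t`, so that it grows until it is everything.
-/

namespace TransClosure

/-! ### Bernoulli random sets -/

section Bernoulli

variable {ι : Type*}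

lemma measurableSet_setOf_superset (T : Finset ι) : MeasurableSet {ω : Set ι | ↑T ⊆ ω} := by
  have h : {ω : Set ι | ↑T ⊆ ω} = ⋂ i ∈ T, {ω | i ∈ ω} := by
    ext ω
    simp [Set.subset_def]
  exact h ▸ T.measurableSet_biInter fun i _ => measurableSet_mem i

lemma measurableSet_setOf_disjoint (U : Finset ι) :
    MeasurableSet {ω : Set ι | Disjoint ↑U ω} := by
  have h : {ω : Set ι | Disjoint ↑U ω} = ⋂ i ∈ U, {ω | i ∉ ω} := by
    ext ω
    simp [Set.disjoint_left]
  exact h ▸ U.measurableSet_biInter fun i _ => measurableSet_notMem i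

open Classical in
lemma setBernoulli_real_cylinder {u : Set ι} (p : I) {T U : Finset ι} (hTu : ↑T ⊆ u)
    (hTU : Disjoint T U) :
    (setBernoulli u p).real {ω | ↑T ⊆ ω ∧ Disjoint ↑U ω} =
      (p : ℝ) ^ T.card * (1 - p : ℝ) ^ {i ∈ U | i ∈ u}.card := by
  let f : ι → Set Prop := fun i => if i ∈ T then {True} else {False}
  have hpi : (fun P : ι → Prop => {i | P i}) ⁻¹' {ω | ↑T ⊆ ω ∧ Disjoint ↑U ω} =
      ((T ∪ U : Finset ι) : Set ι).pi f := by
    ext P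
    simp only [Set.mem_preimage, Set.mem_ofPred_eq, Set.subset_def, Set.disjoint_left,
      Finset.mem_coe, Set.mem_pi, Finset.mem_union, or_imp, forall_and, f]
    refine and_congr (forall₂_congr fun i hi => ?_) (forall₂_congr fun i hi => ?_)
    · simp [hi]
    · simp [Finset.disjoint_right.1 hTU hi]
  rw [measureReal_def, setBernoulli_apply', hpi,
    Measure.infinitePi_pi _ fun i _ => MeasurableSet.of_discrete, ENNReal.toReal_prod,
    Finset.prod_union hTU, Finset.card_filter, ← Finset.prod_pow_eq_pow_sum, ← Finset.prod_const]
  congr 1 <;> refine Finset.prod_congr rfl fun i hi => ?_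
  · have hf : f i = {True} := if_pos hi
    have hu : (i ∈ u) = True := eq_true (hTu hi)
    simp [hf, hu]
  · have hf : f i = {False} := if_neg (Finset.disjoint_right.1 hTU hi)
    by_cases hu : i ∈ u <;> simp [hf, hu, ENNReal.toReal_add]

open Classical in
lemma setBernoulli_real_disjoint (u : Set ι) (p : I) (U : Finset ι) :
    (setBernoulli u p).real {ω | Disjoint ↑U ω} = (1 - p : ℝ) ^ {i ∈ U | i ∈ u}.card := by
  simpa using
    setBernoulli_real_cylinder p (T := ∅) (u := u) (by simp) (Finset.disjoint_empty_left U)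

lemma setBernoulli_real_superset {u : Set ι} (p : I) {T : Finset ι} (hTu : ↑T ⊆ u) :
    (setBernoulli u p).real {ω | ↑T ⊆ ω} = (p : ℝ) ^ T.card := by
  simpa using setBernoulli_real_cylinder p hTu (Finset.disjoint_empty_right T)

lemma setBernoulli_real_superset_le [Countable ι] (u : Set ι) (p : I) (T : Finset ι) :
    (setBernoulli u p).real {ω | ↑T ⊆ ω} ≤ (p : ℝ) ^ T.card := by
  by_cases hTu : ↑T ⊆ u
  · exact (setBernoulli_real_superset p hTu).le
  · have hnull : setBernoulli u p {ω | ↑T ⊆ ω} = 0 :=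
      measure_mono_null (fun ω hω h => hTu (Set.Subset.trans hω h)) setBernoulli_ae_subset
    simpa [measureReal_def, hnull] using pow_nonneg p.2.1 _

lemma setBernoulli_real_forall_not_superset {J : Type*} [Fintype J] {u : Set ι} (p : I)
    {T : J → Finset ι} (hTu : ∀ j, ↑(T j) ⊆ u) (hT : Pairwise (Function.onFun Disjoint T)) :
    (setBernoulli u p).real {ω | ∀ j, ¬ ↑(T j) ⊆ ω} = ∏ j, (1 - (p : ℝ) ^ (T j).card) := by
  classical
  set μ := setBernoulli u p
  have hind : iIndepSet (fun j => {ω : Set ι | ↑(T j) ⊆ ω}) μ := by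
    rw [iIndepSet_iff_meas_biInter fun j => measurableSet_setOf_superset _]
    intro s
    have hinter : ⋂ j ∈ s, {ω : Set ι | ↑(T j) ⊆ ω} = {ω | ↑(s.biUnion T) ⊆ ω} := by
      ext ω
      simp
    rw [hinter, ← ENNReal.toReal_eq_toReal_iff' (by simp) (by simp [ENNReal.prod_ne_top]),
      ENNReal.toReal_prod, ← measureReal_def,
      setBernoulli_real_superset p (by simpa using fun j _ => hTu j),
      Finset.card_biUnion fun i _ j _ hij => hT hij, ← Finset.prod_pow_eq_pow_sum]
    exact Finset.prod_congr rfl fun j _ => (setBernoulli_real_superset p (hTu j)).symm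
  have hcompl := ((iIndepSet_iff_iIndep _ _).1 hind).meas_iInter
    (s := fun j => {ω : Set ι | ↑(T j) ⊆ ω}ᶜ)
    fun j => (MeasurableSpace.measurableSet_generateFrom (by simp)).compl
  have hset : {ω : Set ι | ∀ j, ¬ ↑(T j) ⊆ ω} = ⋂ j, {ω : Set ι | ↑(T j) ⊆ ω}ᶜ := by
    ext ω
    simp
  rw [hset, measureReal_def, hcompl, ENNReal.toReal_prod]
  refine Finset.prod_congr rfl fun j _ => ?_
  rw [← measureReal_def, probReal_compl_eq_one_sub (measurableSet_setOf_superset _),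
    setBernoulli_real_superset p (hTu j)]

lemma generateFrom_range_setOf_disjoint :
    MeasurableSpace.generateFrom (Set.range fun U : Finset ι => {ω : Set ι | Disjoint ↑U ω}) =
      Set.instMeasurableSpace := by
  refine le_antisymm (MeasurableSpace.generateFrom_le ?_) (iSup_le fun i => ?_)
  · rintro _ ⟨U, rfl⟩
    exact measurableSet_setOf_disjoint U
  · let := MeasurableSpace.generateFrom
      (Set.range fun U : Finset ι => {ω : Set ι | Disjoint ↑U ω})
    have hmem : MeasurableSet[this] {ω : Set ι | i ∈ ω} := by
      refine .of_compl (MeasurableSpace.measurableSet_generateFrom ⟨{i}, ?_⟩)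
      ext ω
      simp
    exact (@measurableSet_setOfPred _ this _ |>.1 hmem).comap_le

lemma measure_set_ext_of_disjoint {μ ν : Measure (Set ι)} [IsProbabilityMeasure μ]
    [IsProbabilityMeasure ν]
    (h : ∀ U : Finset ι, μ.real {ω | Disjoint ↑U ω} = ν.real {ω | Disjoint ↑U ω}) : μ = ν := by
  classical
  refine ext_of_generate_finite _ generateFrom_range_setOf_disjoint.symm ?_ ?_ (by simp)
  · rintro _ ⟨U, rfl⟩ _ ⟨W, rfl⟩ _
    refine ⟨U ∪ W, ?_⟩
    ext ω
    simp
  · rintro _ ⟨U, rfl⟩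
    exact (measureReal_eq_measureReal_iff).1 (h U)

lemma setBernoulli_eq_map_union_inter (u : Set ι) {p p₁ p₂ : I}
    (h : (1 - p : ℝ) = (1 - p₁) * (1 - p₂)) :
    setBernoulli u p = ((setBernoulli (Set.univ : Set ι) p₁).prod
      (setBernoulli (Set.univ : Set ι) p₂)).map fun ω => (ω.1 ∪ ω.2) ∩ u := by
  classical
  have hmeas : Measurable fun ω : Set ι × Set ι => (ω.1 ∪ ω.2) ∩ u := by
    refine measurable_set_iff.2 fun i => ?_
    exact (((measurable_set_mem i).comp measurable_fst).or
      ((measurable_set_mem i).comp measurable_snd)).and measurable_const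
  have := Measure.isProbabilityMeasure_map hmeas.aemeasurable
    (μ := (setBernoulli (Set.univ : Set ι) p₁).prod (setBernoulli Set.univ p₂))
  refine measure_set_ext_of_disjoint fun U => ?_
  have hpre : (fun ω : Set ι × Set ι => (ω.1 ∪ ω.2) ∩ u) ⁻¹' {ω | Disjoint ↑U ω} =
      {ω | Disjoint ↑{i ∈ U | i ∈ u} ω} ×ˢ {ω | Disjoint ↑{i ∈ U | i ∈ u} ω} := by
    ext ω
    simp only [Set.mem_preimage, Set.mem_ofPred_eq, Set.mem_prod, Set.disjoint_left,
      Finset.mem_coe, Finset.mem_filter, Set.mem_inter_iff, Set.mem_union]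
    grind
  rw [map_measureReal_apply hmeas (measurableSet_setOf_disjoint U), hpre, measureReal_prod_prod,
    setBernoulli_real_disjoint, setBernoulli_real_disjoint, setBernoulli_real_disjoint, h, mul_pow]
  simp

lemma map_preimage_setBernoulli {κ : Type*} {f : κ → ι} (hf : f.Injective) (u : Set ι) (p : I) :
    (setBernoulli u p).map (f ⁻¹' ·) = setBernoulli (f ⁻¹' u) p := by
  classical
  have hmeas : Measurable fun ω : Set ι => f ⁻¹' ω :=
    measurable_set_iff.2 fun i => measurable_set_mem (f i)
  have := Measure.isProbabilityMeasure_map hmeas.aemeasurable (μ := setBernoulli u p)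
  refine measure_set_ext_of_disjoint fun U => ?_
  have hpre : (fun ω : Set ι => f ⁻¹' ω) ⁻¹' {ω | Disjoint ↑U ω} =
      {ω | Disjoint ↑(U.image f) ω} := by
    ext ω
    simp [Set.disjoint_left]
  rw [map_measureReal_apply hmeas (measurableSet_setOf_disjoint U), hpre,
    setBernoulli_real_disjoint, setBernoulli_real_disjoint, Finset.filter_image,
    Finset.card_image_of_injective _ hf]
  rfl

end Bernoulli

/-! ### Connected sets of vertices -/

section Connected

variable {V : Type*} {G : SimpleGraph V}

lemma exists_adj_of_preconnected_induce {T A : Set V} (hT : (G.induce T).Preconnected)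
    {a b : V} (ha : a ∈ T) (haA : a ∈ A) (hb : b ∈ T) (hbA : b ∉ A) :
    ∃ x ∈ A, ∃ y ∈ T \ A, G.Adj x y := by
  obtain ⟨q⟩ := hT ⟨a, ha⟩ ⟨b, hb⟩
  obtain ⟨d, _, hfst, hsnd⟩ := q.exists_boundary_dart (Subtype.val ⁻¹' A) haA hbA
  exact ⟨d.fst, hfst, d.snd, ⟨d.snd.2, hsnd⟩, d.adj⟩

lemma exists_walk_support_eq_insert [DecidableEq V] {u v x y : V} (q : G.Walk u v)
    (hx : x ∈ q.support) (hxy : G.Adj x y) :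
    ∃ q' : G.Walk u v, q'.support.toFinset = insert y q.support.toFinset ∧
      q'.length = q.length + 2 := by
  have hspec := q.take_spec hx
  refine ⟨(q.takeUntil x hx).append (.cons hxy (.cons hxy.symm (q.dropUntil x hx))), ?_, ?_⟩
  · ext z
    have hz : z ∈ q.support ↔ z ∈ (q.takeUntil x hx).support ∨ z ∈ (q.dropUntil x hx).support := by
      rw [← SimpleGraph.Walk.mem_support_append_iff, hspec]
    have hzx : z = x → z ∈ (q.takeUntil x hx).support := by
      rintro rfl
      exact SimpleGraph.Walk.end_mem_support _
    simp only [List.mem_toFinset, SimpleGraph.Walk.mem_support_append_iff,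
      SimpleGraph.Walk.support_cons, List.mem_cons, Finset.mem_insert, hz]
    tauto
  · have hlength := congrArg SimpleGraph.Walk.length hspec
    simp only [SimpleGraph.Walk.length_append, SimpleGraph.Walk.length_cons] at hlength ⊢
    omega

lemma exists_closed_walk_card_support [DecidableEq V] {T : Finset V} {v : V} (hv : v ∈ T)
    (hT : (G.induce (T : Set V)).Preconnected) {k : ℕ} (hk : k + 1 ≤ T.card) :
    ∃ q : G.Walk v v, q.support.toFinset ⊆ T ∧ q.support.toFinset.card = k + 1 ∧
      q.length = 2 * k := by
  induction k with
  | zero => exact ⟨.nil, by simpa using hv, by simp, by simp⟩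
  | succ k ih =>
    obtain ⟨q, hqT, hcard, hlength⟩ := ih (by omega)
    obtain ⟨b, hb, hbq⟩ := Finset.exists_mem_notMem_of_card_lt_card (hcard.trans_lt hk)
    obtain ⟨x, hx, y, ⟨hy, hyq⟩, hxy⟩ :=
      exists_adj_of_preconnected_induce (A := ↑q.support.toFinset) hT hv (by simp) hb hbq
    obtain ⟨q', hq', hlength'⟩ := exists_walk_support_eq_insert q (by simpa using hx) hxy
    refine ⟨q', hq' ▸ Finset.insert_subset hy hqT, ?_, by omega⟩
    rw [hq', Finset.card_insert_of_notMem hyq, hcard]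

lemma exists_closed_walk_support_eq [DecidableEq V] {T : Finset V} {v : V} (hv : v ∈ T)
    (hT : (G.induce (T : Set V)).Preconnected) :
    ∃ q : G.Walk v v, q.support.toFinset = T ∧ q.length + 2 = 2 * T.card := by
  have hpos : 0 < T.card := Finset.card_pos.2 ⟨v, hv⟩
  obtain ⟨q, hqT, hcard, hlength⟩ :=
    exists_closed_walk_card_support hv hT (k := T.card - 1) (by omega)
  exact ⟨q, Finset.eq_of_subset_of_card_le hqT (by omega), by omega⟩

variable [Fintype V]

open Classical in
/-- The sets of vertices visited by the walks of `m` steps from a given vertex, where each step may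
stay in place. They are used to count the connected sets containing that vertex. -/
noncomputable def walkSupports (G : SimpleGraph V) : ℕ → V → Finset (Finset V)
  | 0, v => {{v}}
  | m + 1, v => (insert v (G.neighborFinset v)).biUnion
      fun w => (walkSupports G m w).image (insert v)

open Classical in
lemma card_insert_neighborFinset_le {Δ : ℕ} {v : V} (hv : (G.neighborSet v).ncard ≤ Δ) :
    (insert v (G.neighborFinset v)).card ≤ Δ + 1 := by
  refine (Finset.card_insert_le _ _).trans (Nat.succ_le_succ ?_)
  rwa [← Set.ncard_coe_finset, SimpleGraph.coe_neighborFinset]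

lemma card_walkSupports_le {Δ : ℕ} (hG : ∀ v, (G.neighborSet v).ncard ≤ Δ) (m : ℕ) (v : V) :
    (walkSupports G m v).card ≤ (Δ + 1) ^ m := by
  classical
  induction m generalizing v with
  | zero => simp [walkSupports]
  | succ m ih =>
    rw [walkSupports, pow_succ']
    calc _ ≤ (insert v (G.neighborFinset v)).card * (Δ + 1) ^ m :=
          Finset.card_biUnion_le_card_mul _ _ _ fun w _ => Finset.card_image_le.trans (ih w)
      _ ≤ (Δ + 1) * (Δ + 1) ^ m := Nat.mul_le_mul_right _ (card_insert_neighborFinset_le (hG v))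

lemma mem_of_mem_walkSupports {m : ℕ} {v : V} {S : Finset V} (h : S ∈ walkSupports G m v) :
    v ∈ S := by
  classical
  cases m with
  | zero => simp_all [walkSupports]
  | succ m =>
    rw [walkSupports, Finset.mem_biUnion] at h
    obtain ⟨w, _, h⟩ := h
    obtain ⟨S', _, rfl⟩ := Finset.mem_image.1 h
    exact Finset.mem_insert_self v S'

lemma walkSupports_mono {m m' : ℕ} (hm : m ≤ m') (v : V) :
    walkSupports G m v ⊆ walkSupports G m' v := by
  classical
  induction m', hm using Nat.le_induction with
  | base => exact Finset.Subset.refl _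
  | succ m' _ ih =>
    intro S hS
    rw [walkSupports, Finset.mem_biUnion]
    exact ⟨v, Finset.mem_insert_self v _, Finset.mem_image.2
      ⟨S, ih hS, Finset.insert_eq_of_mem (mem_of_mem_walkSupports hS)⟩⟩

open Classical in
lemma support_mem_walkSupports {u v : V} (q : G.Walk u v) :
    q.support.toFinset ∈ walkSupports G q.length u := by
  induction q with
  | nil => simp [walkSupports]
  | @cons u w v h q ih =>
    rw [SimpleGraph.Walk.length_cons, walkSupports, Finset.mem_biUnion]
    refine ⟨w, Finset.mem_insert_of_mem ((G.mem_neighborFinset u w).2 h),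
      Finset.mem_image.2 ⟨_, ih, ?_⟩⟩
    ext z
    simp

lemma mem_walkSupports_of_preconnected {T : Finset V} {v : V} (hv : v ∈ T)
    (hT : (G.induce (T : Set V)).Preconnected) {m : ℕ} (hm : 2 * T.card ≤ m) :
    T ∈ walkSupports G m v := by
  classical
  obtain ⟨q, rfl, hlength⟩ := exists_closed_walk_support_eq hv hT
  exact walkSupports_mono (by omega) v (support_mem_walkSupports q)

end Connected

/-! ### Witness trees of occupied edges -/

section Witness

variable {V : Type*} {E0 Eopen : Set (V × V)}

lemma length_le_of_walkIn {m : ℕ} {i j : V} (h : WalkIn E0 m i j) : length E0 (i, j) ≤ m :=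
  iInf₂_le m h

lemma WalkIn.concat {m : ℕ} {i j k : V} (h : WalkIn E0 m i j) (hk : (j, k) ∈ E0) :
    WalkIn E0 (m + 1) i k := by
  induction m generalizing i with
  | zero =>
    obtain rfl : i = j := h
    exact ⟨k, hk, rfl⟩
  | succ m ih =>
    obtain ⟨l, hl, h⟩ := h
    exact ⟨l, hl, ih h⟩

lemma length_self (i : V) : length E0 (i, i) = 0 :=
  le_antisymm (length_le_of_walkIn (m := 0) rfl) zero_le

lemma length_le_length_add_one {i j k : V} (h : (j, k) ∈ E0) :
    length E0 (i, k) ≤ length E0 (i, j) + 1 := by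
  have hadd : length E0 (i, j) + 1 = ⨅ m : {m // WalkIn E0 m i j}, ((m : ℕ∞) + 1) := by
    rw [length, iInf_subtype', ENat.iInf_add]
  rw [hadd]
  exact le_iInf fun m => by exact_mod_cast length_le_of_walkIn (m.2.concat h)

/-- The unoriented graph obtained from an oriented one by forgetting the orientation and the
self-loops. -/
def underlying (E0 : Set (V × V)) : SimpleGraph V :=
  SimpleGraph.fromRel fun i j => (i, j) ∈ E0

lemma underlying_adj {i j : V} :
    (underlying E0).Adj i j ↔ i ≠ j ∧ ((i, j) ∈ E0 ∨ (j, i) ∈ E0) :=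
  SimpleGraph.fromRel_adj _ _ _

/-- `Spans E0 Eopen T i j` says that the edge `(i, j)` becomes occupied by a tree of successive
applications of the rule in which all vertices involved are those of `T`. -/
inductive Spans [DecidableEq V] (E0 Eopen : Set (V × V)) : Finset V → V → V → Prop
  | edge {i j : V} (h : (i, j) ∈ E0) : Spans E0 Eopen {i, j} i j
  | step {T₁ T₂ : Finset V} {i k j : V} (h₁ : Spans E0 Eopen T₁ i k) (h₂ : Spans E0 Eopen T₂ k j)
      (h : (i, j) ∈ Eopen) : Spans E0 Eopen (T₁ ∪ T₂) i j

/-- The edge `e = (w, v)` is the second of the two edges used by the rule: for some `x ∈ T`, the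
edge `(x, v)` is open and `(x, w)` is initial or open. -/
def ReinforcedIn (E0 Eopen : Set (V × V)) (T : Finset V) (e : V × V) : Prop :=
  ∃ x ∈ T, (x, e.2) ∈ Eopen ∧ (x, e.1) ∈ E0 ∪ Eopen

/-- The edge `e = (w, v)` is the first of the two edges used by the rule: for some `y ∈ T`, the
edge `(w, y)` is open and `(v, y)` is initial or open. -/
def ReinforcedOut (E0 Eopen : Set (V × V)) (T : Finset V) (e : V × V) : Prop :=
  ∃ y ∈ T, (e.1, y) ∈ Eopen ∧ (e.2, y) ∈ E0 ∪ Eopen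

/-- The initial edges in `T` which may take part in an application of the rule whose third vertex
is in `T`. -/
def Reinforced (E0 Eopen : Set (V × V)) (T : Finset V) (e : V × V) : Prop :=
  e ∈ E0 ∧ e.1 ∈ T ∧ e.2 ∈ T ∧ (ReinforcedIn E0 Eopen T e ∨ ReinforcedOut E0 Eopen T e)

lemma Reinforced.mono {T T' : Finset V} (hT : T ⊆ T') {e : V × V}
    (h : Reinforced E0 Eopen T e) : Reinforced E0 Eopen T' e := by
  obtain ⟨he, hfst, hsnd, ⟨x, hx, h⟩ | ⟨y, hy, h⟩⟩ := h
  · exact ⟨he, hT hfst, hT hsnd, .inl ⟨x, hT hx, h⟩⟩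
  · exact ⟨he, hT hfst, hT hsnd, .inr ⟨y, hT hy, h⟩⟩

namespace Spans

variable [DecidableEq V] {T : Finset V} {i j : V}

lemma exists_of_mem_eventuallyOccupied {e : V × V} (h : e ∈ eventuallyOccupied E0 Eopen) :
    ∃ T, Spans E0 Eopen T e.1 e.2 := by
  obtain ⟨t, ht⟩ := Set.mem_iUnion.1 h
  clear h
  induction t generalizing e with
  | zero => exact ⟨_, .edge ht⟩
  | succ t ih =>
    rcases ht with ht | ⟨hopen, k, h₁, h₂⟩
    · exact ih ht
    · obtain ⟨T₁, hT₁⟩ := ih h₁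
      obtain ⟨T₂, hT₂⟩ := ih h₂
      exact ⟨_, .step hT₁ hT₂ hopen⟩

lemma mem_union (h : Spans E0 Eopen T i j) : (i, j) ∈ E0 ∪ Eopen := by
  cases h with
  | edge h => exact .inl h
  | step _ _ h => exact .inr h

lemma ends_mem (h : Spans E0 Eopen T i j) : i ∈ T ∧ j ∈ T := by
  induction h with
  | edge _ => simp
  | step _ _ _ ih₁ ih₂ => simp [ih₁, ih₂]

lemma exists_length_eq (h : Spans E0 Eopen T i j) {o : V} {t : ℕ∞} (hi : length E0 (o, i) ≤ t)
    (hj : t ≤ length E0 (o, j)) : ∃ x ∈ T, length E0 (o, x) = t := by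
  induction h with
  | @edge i j h =>
    rcases hi.eq_or_lt with hi | hi
    · exact ⟨i, by simp, hi⟩
    · exact ⟨j, by simp, le_antisymm
        ((length_le_length_add_one h).trans (Order.add_one_le_of_lt hi)) hj⟩
  | @step T₁ T₂ i k j _ _ _ ih₁ ih₂ =>
    rcases le_total t (length E0 (o, k)) with hk | hk
    · obtain ⟨x, hx, hxt⟩ := ih₁ hi hk
      exact ⟨x, Finset.mem_union_left _ hx, hxt⟩
    · obtain ⟨x, hx, hxt⟩ := ih₂ hk hj
      exact ⟨x, Finset.mem_union_right _ hx, hxt⟩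

lemma le_card_of_le_length (h : Spans E0 Eopen T i j) {L : ℕ} (hL : (L : ℕ∞) ≤ length E0 (i, j)) :
    L ≤ T.card := by
  have hsub : (Finset.range L).image (fun m : ℕ => (m : ℕ∞)) ⊆
      T.image fun x => length E0 (i, x) := by
    refine Finset.image_subset_iff.2 fun m hm => Finset.mem_image.2 ?_
    have hmL : (m : ℕ∞) ≤ L := by exact_mod_cast (Finset.mem_range.1 hm).le
    exact h.exists_length_eq (by simp [length_self]) (hmL.trans hL)
  have hcard := (Finset.card_le_card hsub).trans Finset.card_image_le
  rwa [Finset.card_image_of_injective _ Nat.cast_injective, Finset.card_range] at hcard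

lemma exists_card_mem_Icc (h : Spans E0 Eopen T i j) {L : ℕ} (hL : 1 ≤ L) (hT : L ≤ T.card) :
    ∃ T' i' j', Spans E0 Eopen T' i' j' ∧ T'.card ∈ Set.Icc L (2 * L) := by
  induction h with
  | @edge i j h => exact ⟨_, i, j, .edge h, hT, Finset.card_le_two.trans (by omega)⟩
  | @step T₁ T₂ i k j h₁ h₂ hopen ih₁ ih₂ =>
    by_cases hcard : (T₁ ∪ T₂).card ≤ 2 * L
    · exact ⟨_, i, j, .step h₁ h₂ hopen, hT, hcard⟩
    · by_cases hT₁ : L ≤ T₁.card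
      · exact ih₁ hT₁
      · exact ih₂ (by have := Finset.card_union_le T₁ T₂; omega)

lemma preconnected_induce (h : Spans E0 Eopen T i j) :
    ((underlying E0).induce (T : Set V)).Preconnected := by
  induction h with
  | @edge i j h =>
    rw [Finset.coe_pair]
    by_cases hij : i = j
    · subst hij
      rw [Set.pair_eq_singleton]
      exact .of_subsingleton
    · exact (SimpleGraph.induce_pair_connected_of_adj
        (underlying_adj.2 ⟨hij, .inl h⟩)).preconnected
  | @step T₁ T₂ i k j h₁ h₂ _ ih₁ ih₂ =>
    rw [Finset.coe_union]
    exact (SimpleGraph.induce_union_connected ih₁ ih₂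
      ⟨k, h₁.ends_mem.2, h₂.ends_mem.1⟩).preconnected

lemma eq_pair_or_forall_exists_reinforced (h : Spans E0 Eopen T i j) :
    ((i, j) ∈ E0 ∧ T = {i, j}) ∨
      ∀ t ∈ T, ∃ e, Reinforced E0 Eopen T e ∧ (t = e.1 ∨ t = e.2) := by
  induction h with
  | edge h => exact .inl ⟨h, rfl⟩
  | @step T₁ T₂ i k j h₁ h₂ hopen ih₁ ih₂ =>
    refine .inr fun t ht => ?_
    rcases Finset.mem_union.1 ht with ht | ht
    · rcases ih₁ with ⟨h, rfl⟩ | ih₁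
      · have hout : ReinforcedOut E0 Eopen ({i, k} ∪ T₂) (i, k) :=
          ⟨j, Finset.mem_union_right _ h₂.ends_mem.2, hopen, h₂.mem_union⟩
        exact ⟨(i, k), ⟨h, by simp, by simp, .inr hout⟩, by simpa using ht⟩
      · obtain ⟨e, he, hte⟩ := ih₁ t ht
        exact ⟨e, he.mono Finset.subset_union_left, hte⟩
    · rcases ih₂ with ⟨h, rfl⟩ | ih₂
      · have hin : ReinforcedIn E0 Eopen (T₁ ∪ {k, j}) (k, j) :=
          ⟨i, Finset.mem_union_left _ h₁.ends_mem.1, hopen, h₁.mem_union⟩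
        exact ⟨(k, j), ⟨h, by simp, by simp, .inl hin⟩, by simpa using ht⟩
      · obtain ⟨e, he, hte⟩ := ih₂ t ht
        exact ⟨e, he.mono Finset.subset_union_right, hte⟩

end Spans

end Witness

/-! ### Matchings of reinforced edges -/

section Matching

variable {V : Type*}

/-- The two ends of an oriented edge. A matching is a set of edges with pairwise disjoint ends. -/
def ends (e : V × V) : Set V := {e.1, e.2}

lemma fst_mem_ends (e : V × V) : e.1 ∈ ends e := Set.mem_insert _ _

lemma snd_mem_ends (e : V × V) : e.2 ∈ ends e := Set.mem_insert_of_mem _ rfl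

lemma exists_matching_forall_exists_not_disjoint (R : Finset (V × V)) :
    ∃ M ⊆ R, (M : Set (V × V)).PairwiseDisjoint ends ∧
      ∀ e ∈ R, ∃ f ∈ M, (ends e ∩ ends f).Nonempty := by
  obtain ⟨M, hMR, hM, hmax⟩ := Vitali.exists_disjoint_subfamily_covering_enlargement
    ends (R : Set (V × V)) 0 2 one_lt_two (fun _ _ => le_rfl) 0 (fun _ _ => le_rfl)
    fun e _ => ⟨e.1, fst_mem_ends e⟩
  lift M to Finset (V × V) using R.finite_toSet.subset hMR
  refine ⟨M, mod_cast hMR, hM, fun e he => ?_⟩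
  obtain ⟨f, hf, hef, _⟩ := hmax e he
  exact ⟨f, hf, hef⟩

lemma exists_matching_card_le [Finite V] {G : SimpleGraph V} {Δ : ℕ}
    (hG : ∀ v, (G.neighborSet v).ncard ≤ Δ) {T : Finset V} {R : Finset (V × V)}
    (hRG : ∀ e ∈ R, G.Adj e.1 e.2) (hT : ∀ t ∈ T, ∃ e ∈ R, t ∈ ends e) :
    ∃ M ⊆ R, (M : Set (V × V)).PairwiseDisjoint ends ∧ T.card ≤ 2 * M.card * (Δ + 1) := by
  classical
  have := Fintype.ofFinite V
  obtain ⟨M, hMR, hM, hmax⟩ := exists_matching_forall_exists_not_disjoint R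
  refine ⟨M, hMR, hM, ?_⟩
  have hcover : T ⊆ (M.biUnion fun f => {f.1, f.2}).biUnion
      fun z => insert z (G.neighborFinset z) := by
    intro t ht
    obtain ⟨e, he, hte⟩ := hT t ht
    obtain ⟨f, hf, z, hze, hzf⟩ := hmax e he
    have hadj := hRG e he
    refine Finset.mem_biUnion.2 ⟨z, Finset.mem_biUnion.2 ⟨f, hf, by simpa [ends] using hzf⟩, ?_⟩
    rw [Finset.mem_insert, SimpleGraph.mem_neighborFinset]
    rcases hte with rfl | rfl <;> rcases hze with rfl | rfl
    exacts [.inl rfl, .inr hadj.symm, .inr hadj, .inl rfl]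
  have hends : (M.biUnion fun f => {f.1, f.2}).card ≤ M.card * 2 :=
    Finset.card_biUnion_le_card_mul _ _ _ fun f _ => Finset.card_le_two
  calc T.card ≤ _ := Finset.card_le_card hcover
    _ ≤ (M.biUnion fun f => {f.1, f.2}).card * (Δ + 1) :=
      Finset.card_biUnion_le_card_mul _ _ _ fun z _ => card_insert_neighborFinset_le (hG z)
    _ ≤ 2 * M.card * (Δ + 1) := Nat.mul_le_mul_right _ (by omega)

lemma exists_subset_card_eq_forall_or_forall {α : Type*} {M : Finset α} {P Q : α → Prop} {r : ℕ}
    (h : ∀ x ∈ M, P x ∨ Q x) (hr : 2 * r ≤ M.card) :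
    ∃ N ⊆ M, N.card = r ∧ ((∀ x ∈ N, P x) ∨ ∀ x ∈ N, Q x) := by
  classical
  have hsplit := M.card_filter_add_card_filter_not P
  rcases le_or_gt r (M.filter P).card with hP | hP
  · obtain ⟨N, hN, hcard⟩ := Finset.exists_subset_card_eq hP
    exact ⟨N, hN.trans (Finset.filter_subset _ _), hcard,
      .inl fun x hx => (Finset.mem_filter.1 (hN hx)).2⟩
  · obtain ⟨N, hN, hcard⟩ := Finset.exists_subset_card_eq
      (show r ≤ (M.filter fun x => ¬ P x).card by omega)
    refine ⟨N, hN.trans (Finset.filter_subset _ _), hcard, .inr fun x hx => ?_⟩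
    obtain ⟨hxM, hxP⟩ := Finset.mem_filter.1 (hN hx)
    exact (h x hxM).resolve_left hxP

open Classical in
/-- The matchings of `r` initial edges inside `S`. -/
noncomputable def matchings (E0 : Set (V × V)) (S : Finset V) (r : ℕ) : Finset (Finset (V × V)) :=
  {e ∈ S ×ˢ S | e ∈ E0}.powerset.filter
    fun M => (M : Set (V × V)).PairwiseDisjoint ends ∧ M.card = r

/-- All in- and out-degrees of the oriented graph `E0` are at most `D`. -/
structure DegreesLE (E0 : Set (V × V)) (D : ℕ) : Prop where
  ncard_out_le (v : V) : {w | (v, w) ∈ E0}.ncard ≤ D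
  ncard_in_le (v : V) : {w | (w, v) ∈ E0}.ncard ≤ D

variable {E0 Eopen : Set (V × V)} {D : ℕ} {S : Finset V}

lemma DegreesLE.ncard_neighborSet_underlying_le [Finite V] (hD : DegreesLE E0 D) (v : V) :
    ((underlying E0).neighborSet v).ncard ≤ 2 * D := by
  have hsub : (underlying E0).neighborSet v ⊆ {w | (v, w) ∈ E0} ∪ {w | (w, v) ∈ E0} :=
    fun w hw => (underlying_adj.1 hw).2
  have hcard := (Set.ncard_le_ncard hsub (Set.toFinite _)).trans (Set.ncard_union_le _ _)
  have hout := hD.ncard_out_le v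
  have hin := hD.ncard_in_le v
  omega

open Classical in
lemma DegreesLE.card_filter_product_le [Finite V] (hD : DegreesLE E0 D) :
    {e ∈ S ×ˢ S | e ∈ E0}.card ≤ S.card * D := by
  rw [Finset.card_filter, Finset.sum_product, ← smul_eq_mul]
  refine Finset.sum_le_card_nsmul _ _ _ fun v _ => ?_
  rw [← Finset.card_filter, ← Set.ncard_coe_finset]
  refine (Set.ncard_le_ncard (fun w hw => ?_) (Set.toFinite _)).trans (hD.ncard_out_le v)
  exact (Finset.mem_filter.1 hw).2

open Classical in
lemma DegreesLE.card_matchings_le [Finite V] (hD : DegreesLE E0 D) (r : ℕ) :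
    (matchings E0 S r).card ≤ 2 ^ (S.card * D) := by
  refine (Finset.card_filter_le _ _).trans ?_
  rw [Finset.card_powerset]
  exact Nat.pow_le_pow_right two_pos hD.card_filter_product_le

lemma exists_mem_matchings_reinforced [Finite V] (hloop : ∀ v, (v, v) ∉ E0) (hD : DegreesLE E0 D)
    (hS : ∀ t ∈ S, ∃ e, Reinforced E0 Eopen S e ∧ t ∈ ends e) {L : ℕ} (hL : L ≤ S.card) :
    ∃ M ∈ matchings E0 S (L / (8 * D + 4)),
      (∀ e ∈ M, ReinforcedIn E0 Eopen S e) ∨ ∀ e ∈ M, ReinforcedOut E0 Eopen S e := by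
  classical
  have := Fintype.ofFinite V
  have hadj : ∀ {e}, Reinforced E0 Eopen S e → (underlying E0).Adj e.1 e.2 := fun {e} he =>
    underlying_adj.2 ⟨fun h => hloop e.1 ((Prod.ext rfl h : (e.1, e.1) = e) ▸ he.1), .inl he.1⟩
  obtain ⟨M, hMR, hM, hcard⟩ := exists_matching_card_le hD.ncard_neighborSet_underlying_le
    (T := S) (R := Finset.univ.filter (Reinforced E0 Eopen S))
    (fun e he => hadj (Finset.mem_filter.1 he).2)
    (by simpa using hS)
  have hMR' : ∀ e ∈ M, Reinforced E0 Eopen S e := fun e he => (Finset.mem_filter.1 (hMR he)).2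
  have hr : 2 * (L / (8 * D + 4)) ≤ M.card := by
    have hdiv := Nat.div_mul_le_self L (8 * D + 4)
    exact Nat.le_of_mul_le_mul_right (c := 2 * (2 * D + 1)) (by nlinarith) (by omega)
  obtain ⟨N, hNM, hNcard, hN⟩ :=
    exists_subset_card_eq_forall_or_forall (fun e he => (hMR' e he).2.2.2) hr
  refine ⟨N, Finset.mem_filter.2 ⟨Finset.mem_powerset.2 fun e he => ?_,
    hM.subset (Finset.coe_subset.2 hNM), hNcard⟩, hN⟩
  obtain ⟨hE0, hfst, hsnd, _⟩ := hMR' e (hNM he)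
  exact Finset.mem_filter.2 ⟨Finset.mem_product.2 ⟨hfst, hsnd⟩, hE0⟩

lemma exists_reinforced_matching [Fintype V] (hloop : ∀ v, (v, v) ∉ E0) (hD : DegreesLE E0 D)
    {L : ℕ} (hL : 3 ≤ L) {e : V × V} (he : e ∈ eventuallyOccupied E0 Eopen)
    (hlength : (L : ℕ∞) ≤ length E0 e) :
    ∃ v, ∃ S ∈ walkSupports (underlying E0) (4 * L) v, S.card ≤ 2 * L ∧
      ∃ M ∈ matchings E0 S (L / (8 * D + 4)),
        (∀ e ∈ M, ReinforcedIn E0 Eopen S e) ∨ ∀ e ∈ M, ReinforcedOut E0 Eopen S e := by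
  classical
  obtain ⟨T, hT⟩ := Spans.exists_of_mem_eventuallyOccupied he
  obtain ⟨S, i, j, hS, hLS, hSL⟩ := hT.exists_card_mem_Icc (by omega)
    (hT.le_card_of_le_length hlength)
  have hreinforced : ∀ t ∈ S, ∃ e, Reinforced E0 Eopen S e ∧ t ∈ ends e := by
    refine hS.eq_pair_or_forall_exists_reinforced.resolve_left fun ⟨_, h⟩ => ?_
    have hpair := Finset.card_le_two (a := i) (b := j)
    rw [h] at hLS
    omega
  exact ⟨i, S, mem_walkSupports_of_preconnected hS.ends_mem.1 hS.preconnected_induce (by omega),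
    hSL, exists_mem_matchings_reinforced hloop hD hreinforced hLS⟩

end Matching

/-! ### The probability of a long occupied edge -/

section Subcritical

lemma measureReal_biUnion_finset_le_card_mul {Ω α : Type*} [MeasurableSpace Ω] {μ : Measure Ω}
    {s : Finset α} {A : α → Set Ω} {N : ℕ} {c : ℝ} (hs : s.card ≤ N) (hc : 0 ≤ c)
    (hA : ∀ a ∈ s, μ.real (A a) ≤ c) : μ.real (⋃ a ∈ s, A a) ≤ N * c :=
  calc μ.real (⋃ a ∈ s, A a) ≤ ∑ a ∈ s, μ.real (A a) := measureReal_biUnion_finset_le _ _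
    _ ≤ s.card * c := by simpa using Finset.sum_le_card_nsmul s _ c hA
    _ ≤ N * c := by gcongr

section Bernoulli

variable {ι J κ : Type*} [Countable ι] [Fintype J] (u E0 : Set ι) (p : I)

open Classical in
lemma setBernoulli_real_forall_mem_le {a b : J → ι} (ha : a.Injective) (hb : b.Injective)
    (hab : ∀ j j', a j ≠ b j') :
    (setBernoulli u p).real {ω | ∀ j, a j ∈ ω ∧ b j ∈ E0 ∪ ω} ≤
      ∏ j, if b j ∈ E0 then (p : ℝ) else (p : ℝ) ^ 2 := by
  set A := Finset.univ.image a
  set B := ({j | b j ∉ E0} : Finset J).image b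
  have hAB : Disjoint A B := Finset.disjoint_left.2 fun i hi hi' => by
    obtain ⟨j, _, rfl⟩ := Finset.mem_image.1 hi
    obtain ⟨j', _, h⟩ := Finset.mem_image.1 hi'
    exact hab _ _ h.symm
  have hsub : {ω | ∀ j, a j ∈ ω ∧ b j ∈ E0 ∪ ω} ⊆ {ω | ↑(A ∪ B) ⊆ ω} := fun ω hω i hi => by
    rcases Finset.mem_union.1 hi with hi | hi
    · obtain ⟨j, _, rfl⟩ := Finset.mem_image.1 hi
      exact (hω j).1
    · obtain ⟨j, hj, rfl⟩ := Finset.mem_image.1 hi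
      exact (hω j).2.resolve_left (Finset.mem_filter.1 hj).2
  refine (measureReal_mono hsub).trans ((setBernoulli_real_superset_le u p _).trans_eq ?_)
  rw [Finset.card_union_of_disjoint hAB, Finset.card_image_of_injective _ ha,
    Finset.card_image_of_injective _ hb, pow_add, Finset.card_filter, ← Finset.prod_pow_eq_pow_sum,
    ← Finset.prod_const, ← Finset.prod_mul_distrib]
  exact Finset.prod_congr rfl fun j _ => by split_ifs <;> simp [sq]

open Classical in
lemma setBernoulli_real_forall_exists_le {S : Finset κ} {a b : J → κ → ι} {D : ℕ}
    (ha : ∀ x : J → κ, Function.Injective fun j => a j (x j))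
    (hb : ∀ x : J → κ, Function.Injective fun j => b j (x j))
    (hab : ∀ j j' x x', a j x ≠ b j' x') (hD : ∀ j, {x ∈ S | b j x ∈ E0}.card ≤ D) :
    (setBernoulli u p).real {ω | ∀ j, ∃ x ∈ S, a j x ∈ ω ∧ b j x ∈ E0 ∪ ω} ≤
      (D * p + S.card * p ^ 2 : ℝ) ^ Fintype.card J := by
  have hp := p.2.1
  have hsub : {ω | ∀ j, ∃ x ∈ S, a j x ∈ ω ∧ b j x ∈ E0 ∪ ω} ⊆
      ⋃ x ∈ Fintype.piFinset fun _ : J => S,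
        {ω | ∀ j, a j (x j) ∈ ω ∧ b j (x j) ∈ E0 ∪ ω} := fun ω hω => by
    choose x hx h using hω
    exact Set.mem_iUnion₂.2 ⟨x, Fintype.mem_piFinset.2 hx, h⟩
  have hsum : ∀ j, ∑ x ∈ S, (if b j x ∈ E0 then (p : ℝ) else (p : ℝ) ^ 2) ≤
      D * p + S.card * p ^ 2 := fun j => by
    rw [Finset.sum_ite, Finset.sum_const, Finset.sum_const, nsmul_eq_mul, nsmul_eq_mul]
    gcongr
    exacts [hD j, Finset.filter_subset _ _]
  calc (setBernoulli u p).real {ω | ∀ j, ∃ x ∈ S, a j x ∈ ω ∧ b j x ∈ E0 ∪ ω}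
      ≤ _ := measureReal_mono hsub (measure_ne_top _ _)
    _ ≤ ∑ x ∈ Fintype.piFinset fun _ : J => S,
        (setBernoulli u p).real {ω | ∀ j, a j (x j) ∈ ω ∧ b j (x j) ∈ E0 ∪ ω} :=
      measureReal_biUnion_finset_le _ _
    _ ≤ ∑ x ∈ Fintype.piFinset fun _ : J => S,
        ∏ j, (if b j (x j) ∈ E0 then (p : ℝ) else (p : ℝ) ^ 2) :=
      Finset.sum_le_sum fun x _ =>
        setBernoulli_real_forall_mem_le u E0 p (ha x) (hb x) fun j j' => hab _ _ _ _
    _ = ∏ j, ∑ x ∈ S, (if b j x ∈ E0 then (p : ℝ) else (p : ℝ) ^ 2) :=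
      (Finset.prod_univ_sum _ fun j x => if b j x ∈ E0 then (p : ℝ) else (p : ℝ) ^ 2).symm
    _ ≤ ∏ _j : J, (D * p + S.card * p ^ 2 : ℝ) :=
      Finset.prod_le_prod (fun j _ => Finset.sum_nonneg fun x _ => by positivity) fun j _ => hsum j
    _ = _ := by rw [Finset.prod_const, Finset.card_univ]

end Bernoulli

instance {V : Type*} (E0 : Set (V × V)) (p : I) : IsProbabilityMeasure (openLaw E0 p) := by
  unfold openLaw
  infer_instance

section Matching

variable {V : Type*} {E0 : Set (V × V)} {S : Finset V} {M : Finset (V × V)} {r D : ℕ}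

lemma mem_of_mem_matchings (hM : M ∈ matchings E0 S r) {e : V × V} (he : e ∈ M) : e ∈ E0 := by
  classical
  exact (Finset.mem_filter.1 (Finset.mem_powerset.1 (Finset.mem_filter.1 hM).1 he)).2

lemma card_of_mem_matchings (hM : M ∈ matchings E0 S r) : M.card = r := by
  classical
  exact (Finset.mem_filter.1 hM).2.2

lemma eq_of_mem_ends (hM : M ∈ matchings E0 S r) {e f : M} {z : V} (he : z ∈ ends e.1)
    (hf : z ∈ ends f.1) : e = f := by
  classical
  exact Subtype.ext ((Finset.mem_filter.1 hM).2.1.elim_set e.2 f.2 z he hf)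

lemma eq_of_fst_eq (hM : M ∈ matchings E0 S r) {e f : M} (h : e.1.1 = f.1.1) : e = f :=
  eq_of_mem_ends hM (fst_mem_ends _) (h ▸ fst_mem_ends _)

lemma eq_of_snd_eq (hM : M ∈ matchings E0 S r) {e f : M} (h : e.1.2 = f.1.2) : e = f :=
  eq_of_mem_ends hM (snd_mem_ends _) (h ▸ snd_mem_ends _)

lemma fst_ne_snd_of_mem_matchings (hloop : ∀ v, (v, v) ∉ E0) (hM : M ∈ matchings E0 S r)
    (e f : M) : e.1.1 ≠ f.1.2 := fun h => by
  obtain rfl : e = f := eq_of_mem_ends hM (fst_mem_ends _) (h ▸ snd_mem_ends _)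
  have he := mem_of_mem_matchings hM e.2
  rw [← Prod.mk.eta (p := e.1), ← h] at he
  exact hloop _ he

lemma openLaw_real_forall_reinforcedIn_le [Finite V] (p : I) (hloop : ∀ v, (v, v) ∉ E0)
    (hD : DegreesLE E0 D) (hM : M ∈ matchings E0 S r) :
    (openLaw E0 p).real {Eopen | ∀ e ∈ M, ReinforcedIn E0 Eopen S e} ≤
      (D * p + S.card * p ^ 2 : ℝ) ^ r := by
  classical
  have h := setBernoulli_real_forall_exists_le {e | e.1 ≠ e.2 ∧ e ∉ E0} E0 p
    (J := M) (S := S) (a := fun e x => (x, e.1.2)) (b := fun e x => (x, e.1.1)) (D := D)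
    (fun _ _ _ h => eq_of_snd_eq hM (Prod.ext_iff.1 h).2)
    (fun _ _ _ h => eq_of_fst_eq hM (Prod.ext_iff.1 h).2)
    (fun e f _ _ h => fst_ne_snd_of_mem_matchings hloop hM f e (Prod.ext_iff.1 h).2.symm)
    (fun e => ?_)
  · simpa [openLaw, ReinforcedIn, card_of_mem_matchings hM] using h
  · rw [← Set.ncard_coe_finset]
    exact (Set.ncard_le_ncard fun x hx => (Finset.mem_filter.1 hx).2).trans (hD.ncard_in_le e.1.1)

lemma openLaw_real_forall_reinforcedOut_le [Finite V] (p : I) (hloop : ∀ v, (v, v) ∉ E0)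
    (hD : DegreesLE E0 D) (hM : M ∈ matchings E0 S r) :
    (openLaw E0 p).real {Eopen | ∀ e ∈ M, ReinforcedOut E0 Eopen S e} ≤
      (D * p + S.card * p ^ 2 : ℝ) ^ r := by
  classical
  have h := setBernoulli_real_forall_exists_le {e | e.1 ≠ e.2 ∧ e ∉ E0} E0 p
    (J := M) (S := S) (a := fun e y => (e.1.1, y)) (b := fun e y => (e.1.2, y)) (D := D)
    (fun _ _ _ h => eq_of_fst_eq hM (Prod.ext_iff.1 h).1)
    (fun _ _ _ h => eq_of_snd_eq hM (Prod.ext_iff.1 h).1)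
    (fun e f _ _ h => fst_ne_snd_of_mem_matchings hloop hM e f (Prod.ext_iff.1 h).1)
    (fun e => ?_)
  · simpa [openLaw, ReinforcedOut, card_of_mem_matchings hM] using h
  · rw [← Set.ncard_coe_finset]
    exact (Set.ncard_le_ncard fun y hy => (Finset.mem_filter.1 hy).2).trans (hD.ncard_out_le e.1.2)

lemma openLaw_real_exists_matching_reinforced_le [Finite V] (p : I) (hloop : ∀ v, (v, v) ∉ E0)
    (hD : DegreesLE E0 D) {N : ℕ} (hS : S.card ≤ N) (r : ℕ) :
    (openLaw E0 p).real (⋃ M ∈ matchings E0 S r, {Eopen | (∀ e ∈ M, ReinforcedIn E0 Eopen S e) ∨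
        ∀ e ∈ M, ReinforcedOut E0 Eopen S e}) ≤
      2 ^ (N * D) * (2 * (D * p + N * p ^ 2 : ℝ) ^ r) := by
  have hp := p.2.1
  have hcard : (matchings E0 S r).card ≤ 2 ^ (N * D) :=
    (hD.card_matchings_le r).trans (by gcongr; exact one_le_two)
  refine (measureReal_biUnion_finset_le_card_mul hcard
    (c := 2 * (D * p + N * p ^ 2 : ℝ) ^ r) (by positivity) fun M hM => ?_).trans_eq (by simp)
  calc _ ≤ _ := measureReal_union_le _ _
    _ ≤ _ := add_le_add (openLaw_real_forall_reinforcedIn_le p hloop hD hM)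
      (openLaw_real_forall_reinforcedOut_le p hloop hD hM)
    _ = 2 * (D * p + S.card * p ^ 2 : ℝ) ^ r := (two_mul _).symm
    _ ≤ 2 * (D * p + N * p ^ 2 : ℝ) ^ r := by gcongr

lemma openLaw_real_exists_le_length_le [Fintype V] (p : I) (hloop : ∀ v, (v, v) ∉ E0)
    (hD : DegreesLE E0 D) {L : ℕ} (hL : 3 ≤ L) :
    (openLaw E0 p).real {Eopen | ∃ e ∈ eventuallyOccupied E0 Eopen, (L : ℕ∞) ≤ length E0 e} ≤
      Fintype.card V * ((2 * D + 1) ^ (4 * L) * (2 ^ (2 * L * D) *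
        (2 * (D * p + (2 * L) * p ^ 2 : ℝ) ^ (L / (8 * D + 4))))) := by
  have hp := p.2.1
  set A : Finset V → Set (Set (V × V)) := fun S => ⋃ M ∈ matchings E0 S (L / (8 * D + 4)),
    {Eopen | (∀ e ∈ M, ReinforcedIn E0 Eopen S e) ∨ ∀ e ∈ M, ReinforcedOut E0 Eopen S e}
  set supports : V → Finset (Finset V) := fun v =>
    {S ∈ walkSupports (underlying E0) (4 * L) v | S.card ≤ 2 * L}
  have hsub : {Eopen | ∃ e ∈ eventuallyOccupied E0 Eopen, (L : ℕ∞) ≤ length E0 e} ⊆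
      ⋃ v ∈ Finset.univ, ⋃ S ∈ supports v, A S := by
    rintro Eopen ⟨e, he, hlength⟩
    obtain ⟨v, S, hS, hSL, M, hM, h⟩ := exists_reinforced_matching hloop hD hL he hlength
    exact Set.mem_iUnion₂.2 ⟨v, Finset.mem_univ v, Set.mem_iUnion₂.2
      ⟨S, Finset.mem_filter.2 ⟨hS, hSL⟩, Set.mem_iUnion₂.2 ⟨M, hM, h⟩⟩⟩
  have hcard : ∀ v, (supports v).card ≤ (2 * D + 1) ^ (4 * L) := fun v =>
    (Finset.card_filter_le _ _).trans
      (card_walkSupports_le hD.ncard_neighborSet_underlying_le _ _)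
  refine (measureReal_mono hsub (measure_ne_top _ _)).trans
    (measureReal_biUnion_finset_le_card_mul le_rfl (by positivity) fun v _ => ?_)
  have h := measureReal_biUnion_finset_le_card_mul (μ := openLaw E0 p) (A := A) (hcard v)
    (by positivity) fun S hS =>
      openLaw_real_exists_matching_reinforced_le p hloop hD (Finset.mem_filter.1 hS).2 _
  exact_mod_cast h

end Matching

end Subcritical

/-! ### Subcritical asymptotics -/

section SubcriticalAsymptotics

lemma tendsto_log_natCast_atTop : Tendsto (fun n : ℕ => Real.log n) atTop atTop :=
  Real.tendsto_log_atTop.comp tendsto_natCast_atTop_atTop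

lemma natCeil_le_of_ofReal_le {x : ℝ} {l : ℕ∞} (h : ENNReal.ofReal x ≤ (l : ℝ≥0∞)) :
    ((⌈x⌉₊ : ℕ) : ℕ∞) ≤ l := by
  induction l using ENat.recTopCoe with
  | top => exact le_top
  | coe m =>
    rw [Nat.cast_le, Nat.ceil_le]
    simpa using ENNReal.ofReal_le_iff_le_toReal (by simp) |>.1 h

lemma exp_neg_mul_pow_div_le {B : ℝ} (hB : 0 ≤ B) {N : ℕ} (hN : 0 < N) (L : ℕ) :
    Real.exp (-(B * N)) ^ (L / N) ≤ Real.exp (B * N) * Real.exp (-(B * L)) := by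
  have hdiv : (L : ℝ) ≤ N * ((L / N : ℕ) : ℝ) + N := by
    exact_mod_cast (Nat.lt_mul_div_succ L hN).le.trans_eq (by ring)
  rw [← Real.exp_nat_mul, ← Real.exp_add]
  exact Real.exp_le_exp.2 (by nlinarith)

-- The exponent is chosen so that `K * exp (-(log K + 2 / α)) = exp (-2 / α)`.
lemma pow_mul_exp_neg_le_one_div_sq {α K : ℝ} (hα : 0 < α) (hK : 0 < K) {n L : ℕ} (hn : 0 < n)
    (hL : α * Real.log n ≤ L) :
    K ^ L * Real.exp (-((Real.log K + 2 / α) * L)) ≤ 1 / (n : ℝ) ^ 2 := by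
  have hKL : K ^ L = Real.exp (L * Real.log K) := by rw [Real.exp_nat_mul, Real.exp_log hK]
  have hsq : 1 / (n : ℝ) ^ 2 = Real.exp (-(2 * Real.log n)) := by
    rw [Real.exp_neg, two_mul, Real.exp_add, Real.exp_log (mod_cast hn), one_div, sq]
  have hlog : 2 * Real.log n ≤ 2 / α * L := by
    rw [div_mul_eq_mul_div, le_div_iff₀ hα]
    linarith
  rw [hKL, hsq, ← Real.exp_add]
  exact Real.exp_le_exp.2 (by linarith)

lemma mul_pow_mul_pow_div_le {α K : ℝ} (hα : 0 < α) (hK : 1 ≤ K) {n N L : ℕ} (hn : 0 < n)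
    (hN : 0 < N) (hL : α * Real.log n ≤ L) {x : ℝ} (hx0 : 0 ≤ x)
    (hx : x ≤ Real.exp (-((Real.log K + 2 / α) * N))) :
    n * (K ^ L * (2 * x ^ (L / N))) ≤ 2 * Real.exp ((Real.log K + 2 / α) * N) / n := by
  have hKL := pow_mul_exp_neg_le_one_div_sq hα (zero_lt_one.trans_le hK) hn hL
  set B := Real.log K + 2 / α
  have hB0 : 0 ≤ B := add_nonneg (Real.log_nonneg hK) (by positivity)
  have hpow : x ^ (L / N) ≤ Real.exp (B * N) * Real.exp (-(B * L)) :=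
    (pow_le_pow_left₀ hx0 hx _).trans (exp_neg_mul_pow_div_le hB0 hN L)
  calc (n : ℝ) * (K ^ L * (2 * x ^ (L / N)))
      ≤ n * (K ^ L * (2 * (Real.exp (B * N) * Real.exp (-(B * L))))) := by gcongr
    _ = 2 * Real.exp (B * N) * n * (K ^ L * Real.exp (-(B * L))) := by ring
    _ ≤ 2 * Real.exp (B * N) * n * (1 / (n : ℝ) ^ 2) := by gcongr
    _ = 2 * Real.exp (B * N) / n := by field_simp

lemma eventually_natCeil_mul_log_le {α : ℝ} (hα : 0 < α) :
    ∀ᶠ n : ℕ in atTop, (⌈α * Real.log n⌉₊ : ℝ) ≤ 2 * (α * Real.log n) := by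
  filter_upwards [(tendsto_log_natCast_atTop.const_mul_atTop hα).eventually_ge_atTop 1] with n hn
  linarith [Nat.ceil_lt_add_one (by linarith : 0 ≤ α * Real.log n)]

lemma eventually_mul_add_natCeil_mul_sq_le {α ε D : ℝ} (hα : 0 < α) (hε : 0 < ε) (hD : 0 ≤ D)
    {p : ℕ → I} (hp : ∀ᶠ n : ℕ in atTop, (p n : ℝ) < √(ε / (8 * α)) / √(Real.log n)) :
    ∀ᶠ n : ℕ in atTop, D * p n + (2 * ⌈α * Real.log n⌉₊) * (p n : ℝ) ^ 2 ≤ ε := by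
  set c := √(ε / (8 * α))
  have hc : c ^ 2 = ε / (8 * α) := Real.sq_sqrt (by positivity)
  have hlinear : Tendsto (fun n : ℕ => D * (c / √(Real.log n))) atTop (𝓝 0) := by
    have h := (tendsto_const_nhds (x := c)).div_atTop
      (Real.tendsto_sqrt_atTop.comp tendsto_log_natCast_atTop)
    simpa using h.const_mul D
  filter_upwards [hp, hlinear.eventually_le_const (half_pos hε), eventually_natCeil_mul_log_le hα,
    tendsto_log_natCast_atTop.eventually_gt_atTop 0] with n hpn hlin hceil hlog
  have hp0 := (p n).2.1
  have hsq : (p n : ℝ) ^ 2 ≤ c ^ 2 / Real.log n :=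
    calc (p n : ℝ) ^ 2 ≤ (c / √(Real.log n)) ^ 2 := by gcongr
      _ = c ^ 2 / Real.log n := by rw [div_pow, Real.sq_sqrt hlog.le]
  have hquad : (2 * ⌈α * Real.log n⌉₊) * (p n : ℝ) ^ 2 ≤ ε / 2 :=
    calc (2 * ⌈α * Real.log n⌉₊) * (p n : ℝ) ^ 2
        ≤ (2 * (2 * (α * Real.log n))) * (c ^ 2 / Real.log n) := by gcongr
      _ = ε / 2 := by
        rw [hc]
        field_simp
        norm_num
  have hlin' : D * p n ≤ ε / 2 := le_trans (by gcongr) hlin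
  linarith

theorem exists_tendsto_exists_le_length_zero (D : ℕ) {α : ℝ} (hα : 0 < α) :
    ∃ c : ℝ, 0 < c ∧ ∀ (E0 : (n : ℕ) → Set (Fin n × Fin n)) (p : ℕ → I),
      (∀ᶠ n in atTop, (∀ v, (v, v) ∉ E0 n) ∧ DegreesLE (E0 n) D) →
      (∀ᶠ n : ℕ in atTop, (p n : ℝ) < c / √(Real.log n)) →
      Tendsto (fun n : ℕ => openLaw (E0 n) (p n) {Eopen | ∃ e ∈ eventuallyOccupied (E0 n) Eopen,
        ENNReal.ofReal (α * Real.log n) ≤ (length (E0 n) e : ℝ≥0∞)}) atTop (𝓝 0) := by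
  set K : ℝ := (2 * D + 1) ^ 4 * 2 ^ (2 * D) with hK
  set B : ℝ := (Real.log K + 2 / α) * (8 * D + 4 : ℕ)
  have hK1 : 1 ≤ K := one_le_mul_of_one_le_of_one_le
    (one_le_pow₀ (by linarith [(Nat.cast_nonneg D : (0 : ℝ) ≤ D)])) (one_le_pow₀ one_le_two)
  refine ⟨√(Real.exp (-B) / (8 * α)), by positivity, fun E0 p hE0 hp => ?_⟩
  have hlim : Tendsto (fun n : ℕ => ENNReal.ofReal (2 * Real.exp B / n)) atTop (𝓝 0) := by
    simpa using ENNReal.tendsto_ofReal (tendsto_const_div_atTop_nhds_zero_nat (2 * Real.exp B))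
  refine tendsto_of_tendsto_of_tendsto_of_le_of_le' tendsto_const_nhds hlim (by simp) ?_
  filter_upwards [hE0, (tendsto_log_natCast_atTop.const_mul_atTop hα).eventually_gt_atTop 2,
    eventually_mul_add_natCeil_mul_sq_le hα (Real.exp_pos _) D.cast_nonneg hp,
    eventually_gt_atTop 0] with n ⟨hloop, hD⟩ hlog hε hn
  set L := ⌈α * Real.log n⌉₊
  have hL : α * Real.log n ≤ L := Nat.le_ceil _
  have hL3 : 3 ≤ L := by exact_mod_cast hlog.trans_le hL
  have hp0 := (p n).2.1
  have hlong := openLaw_real_exists_le_length_le (p n) hloop hD hL3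
  have hunion := mul_pow_mul_pow_div_le hα hK1 hn (by omega) hL (by positivity) hε
  have hKL : ∀ y : ℝ, (2 * D + 1 : ℝ) ^ (4 * L) * (2 ^ (2 * L * D) * y) = K ^ L * y := fun y => by
    rw [hK, mul_pow, ← pow_mul, ← pow_mul, mul_right_comm 2 D L, mul_assoc (_ ^ _)]
  rw [hKL, Fintype.card_fin] at hlong
  refine (measure_mono ?_).trans ((ENNReal.le_ofReal_iff_toReal_le (measure_ne_top _ _)
    (by positivity)).2 (hlong.trans hunion))
  rintro Eopen ⟨e, he, hlength⟩
  exact ⟨e, he, natCeil_le_of_ofReal_le hlength⟩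

lemma degreesLE_edges {V : Type*} {G : SimpleGraph V} {D : ℕ}
    (hG : ∀ v, (G.neighborSet v).ncard ≤ D) : DegreesLE (edges G) D where
  ncard_out_le := hG
  ncard_in_le v := by
    have hset : {w | (w, v) ∈ edges G} = G.neighborSet v := by
      ext w
      exact G.adj_comm w v
    exact hset ▸ hG v

lemma tendsto_measure_compl_one {Ω : ℕ → Type*} [∀ n, MeasurableSpace (Ω n)]
    {μ : (n : ℕ) → Measure (Ω n)} [∀ n, IsProbabilityMeasure (μ n)] {A : (n : ℕ) → Set (Ω n)}
    (hA : ∀ n, MeasurableSet (A n)) (h : Tendsto (fun n => μ n (A n)) atTop (𝓝 0)) :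
    Tendsto (fun n => μ n (A n)ᶜ) atTop (𝓝 1) := by
  simp_rw [fun n => prob_compl_eq_one_sub (μ := μ n) (hA n)]
  simpa using ENNReal.Tendsto.sub (tendsto_const_nhds (x := (1 : ℝ≥0∞))) h (by simp)

theorem exists_tendsto_not_exists_lt_length_one (D : ℕ) {α : ℝ} (hα : 0 < α) :
    ∃ c : ℝ, 0 < c ∧ ∀ (G : (n : ℕ) → SimpleGraph (Fin n)) (p : ℕ → I),
      (∀ᶠ n in atTop, ∀ v, ((G n).neighborSet v).ncard ≤ D) →
      (∀ᶠ n : ℕ in atTop, (p n : ℝ) < c / √(Real.log n)) →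
      Tendsto (fun n : ℕ => openLaw (edges (G n)) (p n)
        {Eopen | ¬ ∃ e ∈ eventuallyOccupied (edges (G n)) Eopen,
          ENNReal.ofReal (α * Real.log n) < (length (edges (G n)) e : ℝ≥0∞)}) atTop (𝓝 1) := by
  obtain ⟨c, hc, h⟩ := exists_tendsto_exists_le_length_zero D hα
  refine ⟨c, hc, fun G p hG hp => ?_⟩
  have hlong := h (fun n => edges (G n)) p
    (hG.mono fun n hn => ⟨fun v => (G n).irrefl, degreesLE_edges hn⟩) hp
  refine tendsto_of_tendsto_of_tendsto_of_le_of_le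
    (tendsto_measure_compl_one (fun n => .of_discrete) hlong) tendsto_const_nhds
    (fun n => measure_mono ?_) fun n => prob_le_one
  rintro Eopen hEopen ⟨e, he, hlength⟩
  exact hEopen ⟨e, he, hlength.le⟩

end SubcriticalAsymptotics

/-! ### Disjoint connected sets of a given size -/

section Disjoint

variable {V : Type*} {G : SimpleGraph V}

lemma exists_subset_card_eq_preconnected_induce {T : Finset V}
    (hT : (G.induce (T : Set V)).Preconnected) {k : ℕ} (hk : k + 1 ≤ T.card) :
    ∃ A ⊆ T, A.card = k + 1 ∧ (G.induce (A : Set V)).Preconnected := by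
  classical
  obtain ⟨v, hv⟩ : T.Nonempty := Finset.card_pos.1 (by omega)
  obtain ⟨q, hqT, hcard, _⟩ := exists_closed_walk_card_support hv hT hk
  refine ⟨_, hqT, hcard, ?_⟩
  rw [List.coe_toFinset]
  exact q.connected_induce_support.preconnected

/-- The vertices which can be reached from `v` by a walk that avoids `U`. -/
def reachAvoiding (G : SimpleGraph V) (U : Finset V) (v : V) : Set V :=
  {x | ∃ q : G.Walk v x, ∀ y ∈ q.support, y ∉ U}

lemma preconnected_induce_reachAvoiding (U : Finset V) (v : V) :
    (G.induce (reachAvoiding G U v)).Preconnected := by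
  classical
  have hreachable : ∀ x : reachAvoiding G U v, ∃ hv : v ∈ reachAvoiding G U v,
      (G.induce (reachAvoiding G U v)).Reachable ⟨v, hv⟩ x := by
    rintro ⟨x, q, hq⟩
    have hsub : ∀ y ∈ q.support, y ∈ reachAvoiding G U v := fun y hy =>
      ⟨q.takeUntil y hy, fun z hz => hq z (q.support_takeUntil_subset_support hy hz)⟩
    exact ⟨_, ⟨q.induce _ hsub⟩⟩
  intro x y
  obtain ⟨_, hx⟩ := hreachable x
  obtain ⟨_, hy⟩ := hreachable y
  exact hx.symm.trans hy

lemma exists_adj_mem_reachAvoiding (hG : G.Connected) {U : Finset V} (hU : U.Nonempty) {v : V}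
    (hv : v ∉ U) : ∃ y ∈ U, ∃ x, G.Adj y x ∧ v ∈ reachAvoiding G U x := by
  obtain ⟨u, hu⟩ := hU
  obtain ⟨q⟩ := hG.preconnected v u
  obtain ⟨d, _, ⟨q', hq'⟩, hd⟩ := q.exists_boundary_dart (reachAvoiding G U v)
    ⟨.nil, by simpa using hv⟩ fun ⟨q, hq⟩ => hq u q.end_mem_support hu
  refine ⟨d.snd, ?_, d.fst, d.adj.symm, q'.reverse, fun y hy => hq' y (by simpa using hy)⟩
  by_contra hdU
  refine hd ⟨q'.concat d.adj, fun y hy => ?_⟩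
  rw [SimpleGraph.Walk.support_concat, List.mem_append, List.mem_singleton] at hy
  rcases hy with hy | rfl
  exacts [hq' y hy, hdU]

lemma exists_maximal_disjoint_preconnected [Finite V] (G : SimpleGraph V) (k : ℕ) :
    ∃ F : Finset (Finset V), (∀ A ∈ F, A.card = k + 1 ∧ (G.induce (A : Set V)).Preconnected) ∧
      (F : Set (Finset V)).PairwiseDisjoint id ∧
      ∀ T : Finset V, (G.induce (T : Set V)).Preconnected → (∀ A ∈ F, Disjoint T A) →
        T.card ≤ k := by
  classical
  have := Fintype.ofFinite V
  let P : Finset (Finset V) → Prop := fun F =>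
    (∀ A ∈ F, A.card = k + 1 ∧ (G.induce (A : Set V)).Preconnected) ∧
      (F : Set (Finset V)).PairwiseDisjoint id
  obtain ⟨F, hF, hmax⟩ := Finset.exists_max_image (Finset.univ.filter P) Finset.card
    ⟨∅, by simp [P]⟩
  simp only [Finset.mem_filter, Finset.mem_univ, true_and] at hF hmax
  refine ⟨F, hF.1, hF.2, fun T hT hTF => ?_⟩
  by_contra! hcard
  obtain ⟨A, hAT, hA⟩ := exists_subset_card_eq_preconnected_induce hT hcard
  have hdisj : ∀ B ∈ F, Disjoint A B := fun B hB => (hTF B hB).mono_left hAT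
  have hAF : A ∉ F := fun h => by
    have hempty := Finset.disjoint_self_iff_empty _ |>.1 (hdisj A h)
    simp [hempty] at hA
  have hle := hmax (insert A F) ⟨?_, ?_⟩
  · rw [Finset.card_insert_of_notMem hAF] at hle
    omega
  · exact (Finset.forall_mem_insert _ _ _).2 ⟨hA, hF.1⟩
  · rw [Finset.coe_insert]
    exact hF.2.insert fun B hB _ => hdisj B hB

variable [Fintype V] {k : ℕ}

lemma card_le_card_mul_of_forall_disjoint (hG : G.Connected) {Δ : ℕ}
    (hΔ : ∀ v, (G.neighborSet v).ncard ≤ Δ) {U : Finset V} (hU : U.Nonempty)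
    (hmax : ∀ T : Finset V, (G.induce (T : Set V)).Preconnected → Disjoint T U → T.card ≤ k) :
    Fintype.card V ≤ U.card * (1 + Δ * k) := by
  classical
  have hreach : ∀ v, (reachAvoiding G U v).toFinset.card ≤ k := fun v => by
    refine hmax _ ?_ (Finset.disjoint_left.2 fun x hx => ?_)
    · rw [Set.coe_toFinset]
      exact preconnected_induce_reachAvoiding U v
    · obtain ⟨q, hq⟩ := Set.mem_toFinset.1 hx
      exact hq x q.end_mem_support
  have hcover : (Finset.univ : Finset V) ⊆ U ∪ U.biUnion fun y =>
      (G.neighborFinset y).biUnion fun x => (reachAvoiding G U x).toFinset := fun v _ => by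
    by_cases hv : v ∈ U
    · exact Finset.mem_union_left _ hv
    · simpa [hv] using exists_adj_mem_reachAvoiding hG hU hv
  calc Fintype.card V = (Finset.univ : Finset V).card := Finset.card_univ.symm
    _ ≤ U.card + U.card * (Δ * k) := by
      refine (Finset.card_le_card hcover).trans ((Finset.card_union_le _ _).trans ?_)
      gcongr
      refine Finset.card_biUnion_le_card_mul _ _ _ fun y _ => ?_
      refine (Finset.card_biUnion_le_card_mul _ _ k fun x _ => hreach x).trans ?_
      gcongr
      rw [← Set.ncard_coe_finset, SimpleGraph.coe_neighborFinset]
      exact hΔ y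
    _ = U.card * (1 + Δ * k) := by ring

lemma exists_disjoint_preconnected (hG : G.Connected) {Δ : ℕ}
    (hΔ : ∀ v, (G.neighborSet v).ncard ≤ Δ) (hk : k + 1 ≤ Fintype.card V) :
    ∃ F : Finset (Finset V), (∀ A ∈ F, A.card = k + 1 ∧ (G.induce (A : Set V)).Preconnected) ∧
      (F : Set (Finset V)).PairwiseDisjoint id ∧
      Fintype.card V ≤ F.card * ((k + 1) * (1 + Δ * k)) := by
  classical
  obtain ⟨F, hF, hdisj, hmax⟩ := exists_maximal_disjoint_preconnected G k
  refine ⟨F, hF, hdisj, ?_⟩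
  have hU : (F.biUnion id).Nonempty := by
    by_contra hempty
    rw [Finset.not_nonempty_iff_eq_empty] at hempty
    have huniv := hmax Finset.univ (by
      rw [Finset.coe_univ]
      exact ((SimpleGraph.induceUnivIso G).connected_iff.2 hG).preconnected)
      fun A hA => by
        simp [Finset.subset_empty.1 (hempty ▸ Finset.subset_biUnion_of_mem id hA : A ⊆ ∅)]
    rw [Finset.card_univ] at huniv
    omega
  calc Fintype.card V ≤ (F.biUnion id).card * (1 + Δ * k) :=
        card_le_card_mul_of_forall_disjoint hG hΔ hU fun T hT hTU =>
          hmax T hT ((Finset.disjoint_biUnion_right _ _ _).1 hTU)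
    _ ≤ F.card * (k + 1) * (1 + Δ * k) := by
      gcongr
      exact Finset.card_biUnion_le_card_mul _ _ _ fun A hA => (hF A hA).1.le
    _ = F.card * ((k + 1) * (1 + Δ * k)) := mul_assoc _ _ _

end Disjoint

/-! ### Growth of saturated sets -/

section Growth

variable {V : Type*}

/-- `X` is closed under the rule: two consecutive edges of `X` may be completed to a triangle by an
edge of `ω`. -/
def ClosedUnder (ω X : Set (V × V)) : Prop :=
  ∀ ⦃i k j⦄, i ≠ j → (i, j) ∈ ω → (i, k) ∈ X → (k, j) ∈ X → (i, j) ∈ X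

/-- All edges of `ω` between vertices of `S` are in `X`. -/
def SaturatedOn (ω X : Set (V × V)) (S : Finset V) : Prop :=
  ∀ x ∈ S, ∀ y ∈ S, x ≠ y → (x, y) ∈ ω → (x, y) ∈ X

variable {ω X η : Set (V × V)} {S : Finset V}

lemma ClosedUnder.swap (h : ClosedUnder ω X) :
    ClosedUnder (Prod.swap ⁻¹' ω) (Prod.swap ⁻¹' X) :=
  fun _ _ _ hij ho h₁ h₂ => h hij.symm ho h₂ h₁

lemma SaturatedOn.swap (h : SaturatedOn ω X S) :
    SaturatedOn (Prod.swap ⁻¹' ω) (Prod.swap ⁻¹' X) S :=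
  fun x hx y hy hxy ho => h y hy x hx hxy.symm ho

lemma edges_swap (G : SimpleGraph V) : Prod.swap ⁻¹' edges G = edges G := by
  ext e
  exact G.adj_comm _ _

lemma saturatedOn_of_star (hX : ClosedUnder ω X) {z : V}
    (hz : ∀ x ∈ S, x ≠ z → (z, x) ∈ X ∧ (x, z) ∈ X) : SaturatedOn ω X S := by
  intro x hx y hy hxy ho
  rcases eq_or_ne x z with rfl | hxz
  · exact (hz y hy hxy.symm).1
  rcases eq_or_ne y z with rfl | hyz
  · exact (hz x hx hxz).2
  exact hX hxy ho (hz x hx hxz).2 (hz y hy hyz).1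

lemma ClosedUnder.mem_of_star {G : SimpleGraph V} (hX : ClosedUnder ω X) (hG : edges G ⊆ X)
    (hS : (G.induce (S : Set V)).Preconnected) {z : V} (hzS : z ∈ S)
    (hz : ∀ x ∈ S, x ≠ z → (z, x) ∈ ω) {x : V} (hx : x ∈ S) (hxz : x ≠ z) : (z, x) ∈ X := by
  by_contra hzx
  obtain ⟨a, ha, b, ⟨hbS, hb⟩, hab⟩ := exists_adj_of_preconnected_induce
    (A := {x | x = z ∨ (z, x) ∈ X}) hS hzS (.inl rfl) hx (not_or.2 ⟨hxz, hzx⟩)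
  obtain ⟨hbz, hzb⟩ := not_or.1 hb
  have habX : (a, b) ∈ X := hG hab
  rcases ha with rfl | ha
  · exact hzb habX
  · exact hzb (hX (Ne.symm hbz) (hz b hbS hbz) ha habX)

lemma saturatedOn_of_open_star {G : SimpleGraph V} (hX : ClosedUnder ω X) (hG : edges G ⊆ X)
    (hS : (G.induce (S : Set V)).Preconnected) {z : V} (hzS : z ∈ S)
    (hz : ∀ x ∈ S, x ≠ z → (z, x) ∈ ω ∧ (x, z) ∈ ω) : SaturatedOn ω X S :=
  have hG' : edges G ⊆ Prod.swap ⁻¹' X := edges_swap G ▸ Set.preimage_mono hG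
  saturatedOn_of_star hX fun _ hx hxz =>
    ⟨hX.mem_of_star hG hS hzS (fun x hx h => (hz x hx h).1) hx hxz,
      hX.swap.mem_of_star hG' hS hzS (fun x hx h => (hz x hx h).2) hx hxz⟩

variable [DecidableEq V]

/-- The condition on the sprinkled edges `η` under which every open edge from `S` to `v` becomes
occupied, given that `S` is saturated and `(w, v)` is occupied: every nonempty set `A` of vertices
of `S` other than `w`, which is either a singleton or consists of vertices that `η` joins to `v`,
is joined by `η` to a vertex of `S` outside `A` that is `w` or that `η` joins to `v`. -/
def Expands (η : Set (V × V)) (S : Finset V) (w v : V) : Prop :=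
  ∀ A ⊆ S.erase w, A.Nonempty → ((∀ x ∈ A, (x, v) ∈ η) ∨ A.card = 1) →
    ∃ x ∈ A, ∃ y ∈ S, y ∉ A ∧ (y = w ∨ (y, v) ∈ η) ∧ (x, y) ∈ η

/-- `Expands` for the edges from `S` to `v` as well as for those from `v` to `S`. -/
def Absorbs (η : Set (V × V)) (S : Finset V) (w v : V) : Prop :=
  Expands η S w v ∧ Expands (Prod.swap ⁻¹' η) S w v

namespace SaturatedOn

variable {w v : V}

lemma mem_of_expands_of_mem (hS : SaturatedOn ω X S) (hX : ClosedUnder ω X) (hη : η ⊆ ω)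
    (hv : v ∉ S) (hwv : (w, v) ∈ X) (hexp : Expands η S w v) {x : V} (hx : x ∈ S)
    (hxv : (x, v) ∈ η) : (x, v) ∈ X := by
  classical
  by_contra hxX
  let A := (S.erase w).filter fun y => (y, v) ∈ η ∧ (y, v) ∉ X
  have hxA : x ∈ A := Finset.mem_filter.2
    ⟨Finset.mem_erase.2 ⟨fun h => hxX (h ▸ hwv), hx⟩, hxv, hxX⟩
  obtain ⟨a, ha, y, hy, hyA, hyv, hay⟩ := hexp A (Finset.filter_subset _ _) ⟨x, hxA⟩
    (.inl fun a ha => (Finset.mem_filter.1 ha).2.1)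
  obtain ⟨haS, haη, haX⟩ := Finset.mem_filter.1 ha
  have haS : a ∈ S := Finset.mem_of_mem_erase haS
  have hyX : (y, v) ∈ X := by
    rcases eq_or_ne y w with rfl | hyw
    · exact hwv
    · by_contra hyX
      exact hyA (Finset.mem_filter.2
        ⟨Finset.mem_erase.2 ⟨hyw, hy⟩, hyv.resolve_left hyw, hyX⟩)
  exact haX (hX (ne_of_mem_of_not_mem haS hv) (hη haη)
    (hS a haS y hy (ne_of_mem_of_not_mem ha hyA) (hη hay)) hyX)

lemma mem_of_expands (hS : SaturatedOn ω X S) (hX : ClosedUnder ω X) (hη : η ⊆ ω) (hv : v ∉ S)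
    (hwv : (w, v) ∈ X) (hexp : Expands η S w v) {x : V} (hx : x ∈ S) (hxv : (x, v) ∈ ω) :
    (x, v) ∈ X := by
  rcases eq_or_ne x w with rfl | hxw
  · exact hwv
  obtain ⟨a, ha, y, hy, hyx, hyv, hxy⟩ := hexp {x}
    (Finset.singleton_subset_iff.2 (Finset.mem_erase.2 ⟨hxw, hx⟩)) (Finset.singleton_nonempty x)
    (.inr (Finset.card_singleton x))
  obtain rfl := Finset.mem_singleton.1 ha
  have hyX : (y, v) ∈ X := hyv.elim (fun h => h ▸ hwv)
    (hS.mem_of_expands_of_mem hX hη hv hwv hexp hy)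
  exact hX (ne_of_mem_of_not_mem hx hv) hxv
    (hS a hx y hy (fun h => hyx (Finset.mem_singleton.2 h.symm)) (hη hxy)) hyX

lemma insert_of_absorbs (hS : SaturatedOn ω X S) (hX : ClosedUnder ω X) (hη : η ⊆ ω)
    (hv : v ∉ S) (hwv : (w, v) ∈ X) (hvw : (v, w) ∈ X) (h : Absorbs η S w v) :
    SaturatedOn ω X (insert v S) := by
  intro x hx y hy hxy ho
  rcases Finset.mem_insert.1 hx with rfl | hxS <;> rcases Finset.mem_insert.1 hy with rfl | hyS
  · exact absurd rfl hxy
  · exact hS.swap.mem_of_expands hX.swap (Set.preimage_mono hη) hv (w := w) hvw h.2 hyS ho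
  · exact hS.mem_of_expands hX hη hv hwv h.1 hxS ho
  · exact hS x hxS y hyS hxy ho

end SaturatedOn

variable [Fintype V] {G : SimpleGraph V} {S : ℕ → Finset V} {w v : ℕ → V}

/-- The sets `S i` grow to the whole vertex set: as long as `S i` is not everything, `S (i + 1)`
arises by adding to it the vertex `v i`, which is adjacent to the vertex `w i` of `S i`. -/
structure IsGrowth (G : SimpleGraph V) (S : ℕ → Finset V) (w v : ℕ → V) : Prop where
  succ : ∀ i, S (i + 1) = insert (v i) (S i)
  boundary : ∀ i, S i ≠ Finset.univ → w i ∈ S i ∧ v i ∉ S i ∧ G.Adj (w i) (v i)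

lemma exists_isGrowth (hG : G.Connected) {A : Finset V} (hA : A.Nonempty) :
    ∃ S w v, S 0 = A ∧ IsGrowth G S w v := by
  have hboundary : ∀ T : Finset V, T.Nonempty ∧ T ≠ Finset.univ →
      ∃ w v, w ∈ T ∧ v ∉ T ∧ G.Adj w v := by
    rintro T ⟨⟨a, ha⟩, hT⟩
    obtain ⟨b, hb⟩ : ∃ b, b ∉ T := by
      by_contra! h
      exact hT (Finset.eq_univ_of_forall h)
    obtain ⟨q⟩ := hG.preconnected a b
    obtain ⟨d, -, hfst, hsnd⟩ := q.exists_boundary_dart (T : Set V) ha hb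
    exact ⟨d.fst, d.snd, hfst, hsnd, d.adj⟩
  have := hG.nonempty
  choose! w v hwv using hboundary
  let S : ℕ → Finset V := fun i => i.rec A fun _ T => insert (v T) T
  have hS : ∀ i, (S i).Nonempty := fun i => by
    cases i with
    | zero => exact hA
    | succ i => exact Finset.insert_nonempty _ _
  exact ⟨S, fun i => w (S i), fun i => v (S i), rfl, fun _ => rfl, fun i hi => hwv _ ⟨hS i, hi⟩⟩

lemma IsGrowth.card_eq_min (h : IsGrowth G S w v) (i : ℕ) :
    (S i).card = min ((S 0).card + i) (Fintype.card V) := by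
  induction i with
  | zero => simp [Finset.card_le_univ]
  | succ i ih =>
    by_cases hi : S i = Finset.univ
    · have hcard := ih
      rw [hi, Finset.card_univ] at hcard
      rw [h.succ, hi, Finset.insert_eq_of_mem (Finset.mem_univ _), Finset.card_univ]
      omega
    · have hlt := (Finset.card_lt_iff_ne_univ _).2 hi
      rw [h.succ, Finset.card_insert_of_notMem (h.boundary i hi).2.1]
      omega

lemma IsGrowth.saturatedOn_univ (h : IsGrowth G S w v) (hX : ClosedUnder ω X) (hη : η ⊆ ω)
    (hG : edges G ⊆ X) (habs : ∀ i, S i ≠ Finset.univ → Absorbs η (S i) (w i) (v i))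
    (h0 : SaturatedOn ω X (S 0)) : SaturatedOn ω X Finset.univ := by
  have hS : ∀ i, SaturatedOn ω X (S i) := fun i => by
    induction i with
    | zero => exact h0
    | succ i ih =>
      rw [h.succ]
      by_cases hi : S i = Finset.univ
      · rwa [Finset.insert_eq_of_mem (hi ▸ Finset.mem_univ _)]
      · obtain ⟨-, hv, hadj⟩ := h.boundary i hi
        exact ih.insert_of_absorbs hX hη hv (hG hadj) (hG hadj.symm) (habs i hi)
  have huniv : S (Fintype.card V) = Finset.univ := by
    rw [← Finset.card_eq_iff_eq_univ, h.card_eq_min]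
    omega
  exact huniv ▸ hS _

end Growth

/-! ### Saturation of the eventually occupied edges -/

section Saturation

variable {V : Type*} {E0 Eopen : Set (V × V)}

/-- The edges that may be open: neither self-loops nor initially occupied. -/
def eligible (E0 : Set (V × V)) : Set (V × V) :=
  {e | e.1 ≠ e.2 ∧ e ∉ E0}

/-- Saturation occurs: every open edge is eventually occupied. -/
def Saturates (E0 Eopen : Set (V × V)) : Prop :=
  eventuallyOccupied E0 Eopen = E0 ∪ Eopen

lemma occupied_mono : Monotone (occupied E0 Eopen) :=
  monotone_nat_of_le_succ fun _ => Set.subset_union_left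

lemma subset_eventuallyOccupied : E0 ⊆ eventuallyOccupied E0 Eopen :=
  Set.subset_iUnion (occupied E0 Eopen) 0

lemma eventuallyOccupied_subset : eventuallyOccupied E0 Eopen ⊆ E0 ∪ Eopen := by
  refine Set.iUnion_subset fun t => ?_
  induction t with
  | zero => exact Set.subset_union_left
  | succ t ih => exact Set.union_subset ih fun e he => .inr he.1

lemma mem_eventuallyOccupied {i j k : V} (ho : (i, j) ∈ Eopen)
    (hik : (i, k) ∈ eventuallyOccupied E0 Eopen) (hkj : (k, j) ∈ eventuallyOccupied E0 Eopen) :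
    (i, j) ∈ eventuallyOccupied E0 Eopen := by
  obtain ⟨s, hs⟩ := Set.mem_iUnion.1 hik
  obtain ⟨t, ht⟩ := Set.mem_iUnion.1 hkj
  exact Set.mem_iUnion.2 ⟨max s t + 1, .inr ⟨ho, k, occupied_mono (le_max_left s t) hs,
    occupied_mono (le_max_right s t) ht⟩⟩

lemma closedUnder_eventuallyOccupied (E0 ω : Set (V × V)) :
    ClosedUnder ω (eventuallyOccupied E0 (ω ∩ eligible E0)) := by
  intro i k j hij ho hik hkj
  by_cases h : (i, j) ∈ E0
  · exact subset_eventuallyOccupied h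
  · exact mem_eventuallyOccupied ⟨ho, hij, h⟩ hik hkj

lemma saturates_of_saturatedOn_univ [Fintype V] {ω : Set (V × V)}
    (h : SaturatedOn ω (eventuallyOccupied E0 (ω ∩ eligible E0)) Finset.univ) :
    Saturates E0 (ω ∩ eligible E0) := by
  refine eventuallyOccupied_subset.antisymm (Set.union_subset subset_eventuallyOccupied ?_)
  rintro ⟨x, y⟩ ⟨hω, hxy, -⟩
  exact h x (Finset.mem_univ _) y (Finset.mem_univ _) hxy hω

end Saturation

/-! ### Probability that a vertex is absorbed -/

section BinomialSums

variable {V : Type*} {q : ℝ}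

lemma one_sub_pow_le_exp_neg_mul (hq1 : q ≤ 1) (j : ℕ) : (1 - q) ^ j ≤ Real.exp (-(q * j)) :=
  calc (1 - q) ^ j ≤ Real.exp (-q) ^ j :=
        pow_le_pow_left₀ (by linarith) (Real.one_sub_le_exp_neg q) j
    _ = Real.exp (-(q * j)) := by rw [← Real.exp_nat_mul]; ring_nf

lemma sum_powerset_card_lt_le_exp (S : Finset V) (hq0 : 0 ≤ q) (hq1 : q ≤ 1) {s : ℝ} (hs : 0 ≤ s)
    (m : ℝ) :
    ∑ N ∈ S.powerset with (N.card : ℝ) < m, q ^ N.card * (1 - q) ^ (S.card - N.card) ≤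
      Real.exp (s * m - (1 - Real.exp (-s)) * q * S.card) := by
  have : 0 ≤ 1 - q := by linarith
  have hmarkov : ∀ j : ℕ, (j : ℝ) < m → q ^ j ≤ Real.exp (s * m) * (Real.exp (-s) * q) ^ j :=
    fun j hj => by
      have hexp : 1 ≤ Real.exp (s * m) * Real.exp (-s) ^ j := by
        rw [← Real.exp_nat_mul, ← Real.exp_add]
        exact Real.one_le_exp (by nlinarith)
      rw [mul_pow, ← mul_assoc]
      exact le_mul_of_one_le_left (by positivity) hexp
  calc _ ≤ ∑ N ∈ S.powerset with (N.card : ℝ) < m,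
          Real.exp (s * m) * ((Real.exp (-s) * q) ^ N.card * (1 - q) ^ (S.card - N.card)) := by
        refine Finset.sum_le_sum fun N hN => ?_
        rw [← mul_assoc]
        gcongr
        exact hmarkov _ (Finset.mem_filter.1 hN).2
    _ ≤ ∑ N ∈ S.powerset,
          Real.exp (s * m) * ((Real.exp (-s) * q) ^ N.card * (1 - q) ^ (S.card - N.card)) :=
        Finset.sum_le_sum_of_subset_of_nonneg (Finset.filter_subset _ _)
          fun _ _ _ => by positivity
    _ = Real.exp (s * m) * (1 - (1 - Real.exp (-s)) * q) ^ S.card := by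
        rw [← Finset.mul_sum, Finset.sum_pow_mul_eq_add_pow]
        ring_nf
    _ ≤ Real.exp (s * m) * Real.exp (-((1 - Real.exp (-s)) * q * S.card)) := by
        gcongr
        exact one_sub_pow_le_exp_neg_mul (by nlinarith [Real.exp_pos (-s)]) _
    _ = _ := by rw [← Real.exp_add, ← sub_eq_add_neg]

lemma exp_neg_three_tenths_le : Real.exp (-(3 / 10)) ≤ 3 / 4 := by
  have h := Real.quadratic_le_exp_of_nonneg (show (0 : ℝ) ≤ 3 / 10 by norm_num)
  rw [Real.exp_neg, inv_le_comm₀ (Real.exp_pos _) (by norm_num)]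
  linarith

lemma sum_powerset_card_lt_three_quarters_le (S : Finset V) (hq0 : 0 ≤ q) (hq1 : q ≤ 1) :
    ∑ N ∈ S.powerset with (N.card : ℝ) < 3 / 4 * (q * S.card),
      q ^ N.card * (1 - q) ^ (S.card - N.card) ≤ Real.exp (-(q * S.card / 40)) := by
  refine (sum_powerset_card_lt_le_exp S hq0 hq1 (show (0 : ℝ) ≤ 3 / 10 by norm_num) _).trans
    (Real.exp_le_exp.2 ?_)
  have h : 0 ≤ (3 / 4 - Real.exp (-(3 / 10))) * (q * S.card) :=
    mul_nonneg (sub_nonneg.2 exp_neg_three_tenths_le) (by positivity)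
  linarith

lemma pow_mul_one_sub_pow_mul_le (hq0 : 0 ≤ q) (hq1 : q ≤ 1) {b c : ℕ} (hb : b ≠ 0) (hbc : b ≤ c)
    (hy : ((b : ℝ) + c) * Real.exp (-(q * (b + c) / 2)) ≤ 1) :
    ((b : ℝ) + c) ^ b * (1 - q) ^ (b * c) ≤ (b + c) * Real.exp (-(q * (b + c) / 2)) := by
  have hexp : (1 - q) ^ c ≤ Real.exp (-(q * (b + c) / 2)) := by
    refine (one_sub_pow_le_exp_neg_mul hq1 c).trans (Real.exp_le_exp.2 ?_)
    have h : 0 ≤ q * ((c : ℝ) - b) := mul_nonneg hq0 (sub_nonneg.2 (Nat.cast_le.2 hbc))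
    linarith
  calc ((b : ℝ) + c) ^ b * (1 - q) ^ (b * c)
      = (((b : ℝ) + c) * (1 - q) ^ c) ^ b := by rw [mul_pow, ← pow_mul, mul_comm c]
    _ ≤ (((b : ℝ) + c) * Real.exp (-(q * (b + c) / 2))) ^ b := by
      have : 0 ≤ 1 - q := by linarith
      gcongr
    _ ≤ _ := pow_le_of_le_one (by positivity) hy hb

lemma choose_mul_one_sub_pow_le (hq0 : 0 ≤ q) (hq1 : q ≤ 1) {m a : ℕ} (ha : a ≠ 0) (ham : a ≤ m)
    (hy : ((m : ℝ) + 1) * Real.exp (-(q * (m + 1) / 2)) ≤ 1) :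
    (m.choose a) * (1 - q) ^ (a * (m + 1 - a)) ≤ (m + 1) * Real.exp (-(q * (m + 1) / 2)) := by
  have hbound : ∀ b c : ℕ, b ≠ 0 → b ≤ c → b + c = m + 1 → m.choose a ≤ (m + 1) ^ b →
      m.choose a * (1 - q) ^ (b * c) ≤ (m + 1) * Real.exp (-(q * (m + 1) / 2)) := by
    intro b c hb hbc hsum hchoose
    have hsum' : (m : ℝ) + 1 = b + c := by exact_mod_cast hsum.symm
    have hchoose' : (m.choose a : ℝ) ≤ ((b : ℝ) + c) ^ b := by
      rw [← hsum']
      exact_mod_cast hchoose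
    rw [hsum'] at hy ⊢
    exact (mul_le_mul_of_nonneg_right hchoose' (pow_nonneg (by linarith) _)).trans
      (pow_mul_one_sub_pow_mul_le hq0 hq1 hb hbc hy)
  rcases le_total a (m + 1 - a) with h | h
  · exact hbound a (m + 1 - a) ha h (by omega)
      ((Nat.choose_le_pow m a).trans (Nat.pow_le_pow_left (by omega) a))
  · rw [mul_comm a]
    refine hbound (m + 1 - a) a (by omega) h (by omega) ?_
    rw [← Nat.choose_symm ham]
    exact (Nat.choose_le_pow m _).trans
      ((Nat.pow_le_pow_left (by omega) _).trans (Nat.pow_le_pow_right (by omega) (by omega)))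

lemma sum_powerset_erase_one_sub_pow_le [DecidableEq V] (N : Finset V) (hq0 : 0 ≤ q) (hq1 : q ≤ 1)
    (hy : ((N.card : ℝ) + 1) * Real.exp (-(q * (N.card + 1) / 2)) ≤ 1) :
    ∑ A ∈ N.powerset.erase ∅, (1 - q) ^ (A.card * (N.card + 1 - A.card)) ≤
      N.card * ((N.card + 1) * Real.exp (-(q * (N.card + 1) / 2))) := by
  have hcard := Finset.sum_powerset_apply_card
    (fun a => (1 - q) ^ (a * (N.card + 1 - a))) (x := N)
  rw [Finset.sum_erase_eq_sub (Finset.empty_mem_powerset N), hcard, Finset.sum_range_succ']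
  calc _ = ∑ a ∈ Finset.range N.card,
          (N.card.choose (a + 1)) * (1 - q) ^ ((a + 1) * (N.card + 1 - (a + 1))) := by simp
    _ ≤ ∑ _a ∈ Finset.range N.card, (N.card + 1) * Real.exp (-(q * (N.card + 1) / 2)) :=
        Finset.sum_le_sum fun a ha => choose_mul_one_sub_pow_le hq0 hq1 a.succ_ne_zero
          (Finset.mem_range.1 ha) hy
    _ = _ := by simp

end BinomialSums

section Absorption

variable {V : Type*}

/-- The bound for the probability that a vertex is not absorbed by a saturated set of `t + 1`
vertices. The first term is the probability that fewer than `3qt/4` edges from the set to the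
vertex are open, the second one a union bound over the sets `A` in the definition of `Expands`. -/
noncomputable def absorbBound (q : ℝ) (t : ℕ) : ℝ :=
  Real.exp (-(q * t / 40)) + (t + 1) ^ 2 * Real.exp (-(3 / 8 * q ^ 2 * t))

lemma absorbBound_nonneg (q : ℝ) (t : ℕ) : 0 ≤ absorbBound q t := by
  unfold absorbBound
  positivity

/-- The vertices of `R` that `η` joins to `v`. -/
noncomputable def inNeighbors (η : Set (V × V)) (R : Finset V) (v : V) : Finset V :=
  open Classical in R.filter fun x => (x, v) ∈ η

lemma mem_inNeighbors {η : Set (V × V)} {R : Finset V} {v x : V} :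
    x ∈ inNeighbors η R v ↔ x ∈ R ∧ (x, v) ∈ η := by
  classical exact Finset.mem_filter

lemma inNeighbors_subset (η : Set (V × V)) (R : Finset V) (v : V) : inNeighbors η R v ⊆ R :=
  fun _ hx => (mem_inNeighbors.1 hx).1

lemma inNeighbors_eq_iff [DecidableEq V] {η : Set (V × V)} {R N : Finset V} {v : V} (hN : N ⊆ R) :
    inNeighbors η R v = N ↔ ↑(N ×ˢ {v}) ⊆ η ∧ Disjoint (↑((R \ N) ×ˢ {v})) η := by
  simp only [Finset.ext_iff, mem_inNeighbors, Set.disjoint_left, Set.subset_def,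
    Finset.mem_coe, Finset.mem_product, Finset.mem_singleton, Finset.mem_sdiff, Prod.forall]
  constructor
  · intro h
    refine ⟨?_, ?_⟩
    · rintro x _ ⟨hx, rfl⟩
      exact ((h x).2 hx).2
    · rintro x _ ⟨⟨hx, hxN⟩, rfl⟩ hη
      exact hxN ((h x).1 ⟨hx, hη⟩)
  · rintro ⟨hmem, hnot⟩ x
    refine ⟨fun ⟨hx, hη⟩ => ?_, fun hx => ⟨hN hx, hmem x v ⟨hx, rfl⟩⟩⟩
    by_contra hxN
    exact hnot x v ⟨⟨hx, hxN⟩, rfl⟩ hη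

lemma setBernoulli_univ_real_inNeighbors_eq (q : I) {R N B : Finset V} (hN : N ⊆ R) {v : V}
    (hv : v ∉ B) (A : Finset V) :
    (setBernoulli (Set.univ : Set (V × V)) q).real
      {η | inNeighbors η R v = N ∧ Disjoint (↑(A ×ˢ B)) η} =
      q ^ N.card * (1 - q) ^ (R.card - N.card) * (1 - q) ^ (A.card * B.card) := by
  classical
  have hvB : Disjoint {v} B := Finset.disjoint_singleton_left.2 hv
  have hopen : Disjoint (N ×ˢ {v}) ((R \ N) ×ˢ {v} ∪ A ×ˢ B) := by
    rw [Finset.disjoint_union_right, Finset.disjoint_product, Finset.disjoint_product]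
    exact ⟨.inl Finset.disjoint_sdiff, .inr hvB⟩
  have hclosed : Disjoint ((R \ N) ×ˢ {v}) (A ×ˢ B) := Finset.disjoint_product.2 (.inr hvB)
  have hset : {η : Set (V × V) | inNeighbors η R v = N ∧ Disjoint (↑(A ×ˢ B)) η} =
      {η | ↑(N ×ˢ {v}) ⊆ η ∧ Disjoint (↑((R \ N) ×ˢ {v} ∪ A ×ˢ B)) η} := by
    ext η
    simp only [Set.mem_ofPred_eq, inNeighbors_eq_iff hN, Finset.coe_union, Set.disjoint_union_left,
      and_assoc]
  rw [hset, setBernoulli_real_cylinder q (Set.subset_univ _) hopen]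
  simp only [Set.mem_univ, Finset.filter_true, Finset.card_union_of_disjoint hclosed,
    Finset.card_product, Finset.card_singleton, mul_one, Finset.card_sdiff_of_subset hN, pow_add,
    mul_assoc]

lemma setBernoulli_univ_real_card_inNeighbors_lt_le (q : I) (R : Finset V) (v : V) :
    (setBernoulli (Set.univ : Set (V × V)) q).real
      {η | ((inNeighbors η R v).card : ℝ) < 3 / 4 * (q * R.card)} ≤
      Real.exp (-(q * R.card / 40)) := by
  have hsub : {η | ((inNeighbors η R v).card : ℝ) < 3 / 4 * (q * R.card)} ⊆
      ⋃ N ∈ R.powerset.filter fun N => (N.card : ℝ) < 3 / 4 * (q * R.card),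
        {η | inNeighbors η R v = N} := fun η hη =>
    Set.mem_biUnion (Finset.mem_filter.2
      ⟨Finset.mem_powerset.2 (inNeighbors_subset η R v), hη⟩) rfl
  refine (measureReal_mono hsub (measure_ne_top _ _)).trans
    ((measureReal_biUnion_finset_le _ _).trans ((Finset.sum_congr rfl fun N hN => ?_).trans_le
      (sum_powerset_card_lt_three_quarters_le R q.2.1 q.2.2)))
  simpa using setBernoulli_univ_real_inNeighbors_eq q
    (Finset.mem_powerset.1 (Finset.mem_filter.1 hN).1) (Finset.notMem_empty v) ∅

variable [DecidableEq V]

lemma exists_disjoint_product_of_not_expands {η : Set (V × V)} {S : Finset V} {w v : V}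
    (hw : w ∈ S) (h : ¬ Expands η S w v) :
    ∃ A, (A ∈ (inNeighbors η (S.erase w) v).powerset.erase ∅ ∨ ∃ x ∈ S.erase w, {x} = A) ∧
      Disjoint (↑(A ×ˢ (insert w (inNeighbors η (S.erase w) v) \ A))) η := by
  simp only [Expands, not_forall] at h
  obtain ⟨A, hAS, hA, hAv, hno⟩ := h
  push Not at hno
  refine ⟨A, ?_, ?_⟩
  · rcases hAv with hAv | hAv
    · exact .inl (Finset.mem_erase.2 ⟨hA.ne_empty, Finset.mem_powerset.2 fun x hx =>
        mem_inNeighbors.2 ⟨hAS hx, hAv x hx⟩⟩)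
    · obtain ⟨x, rfl⟩ := Finset.card_eq_one.1 hAv
      exact .inr ⟨x, hAS (Finset.mem_singleton_self x), rfl⟩
  · rw [Set.disjoint_left]
    rintro ⟨x, y⟩ hxy
    obtain ⟨hx, hy⟩ := Finset.mem_product.1 hxy
    obtain ⟨hy, hyA⟩ := Finset.mem_sdiff.1 hy
    rcases Finset.mem_insert.1 hy with rfl | hy
    · exact hno x hx _ hw hyA (.inl rfl)
    · obtain ⟨hyS, hyv⟩ := mem_inNeighbors.1 hy
      exact hno x hx y (Finset.mem_of_mem_erase hyS) hyA (.inr hyv)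

section Cuts

variable {q : ℝ} {R N : Finset V} {w : V}

lemma sum_powerset_erase_cut_le (hq0 : 0 ≤ q) (hq1 : q ≤ 1) (hN : N ⊆ R) (hw : w ∉ R)
    (hcard : 3 / 4 * (q * R.card) ≤ N.card)
    (hε : (R.card + 1) ^ 2 * Real.exp (-(3 / 8 * q ^ 2 * R.card)) ≤ 1) :
    ∑ A ∈ N.powerset.erase ∅, (1 - q) ^ (A.card * (insert w N \ A).card) ≤
      R.card * ((R.card + 1) * Real.exp (-(3 / 8 * q ^ 2 * R.card))) := by
  have hNR : (N.card : ℝ) ≤ R.card := Nat.cast_le.2 (Finset.card_le_card hN)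
  have hexp : Real.exp (-(q * (N.card + 1) / 2)) ≤ Real.exp (-(3 / 8 * q ^ 2 * R.card)) :=
    Real.exp_le_exp.2 (by nlinarith)
  have hmul : (N.card + 1) * Real.exp (-(q * (N.card + 1) / 2)) ≤
      (R.card + 1) * Real.exp (-(3 / 8 * q ^ 2 * R.card)) := by gcongr
  have hle : (R.card + 1) * Real.exp (-(3 / 8 * q ^ 2 * R.card)) ≤ 1 := by
    refine le_trans ?_ hε
    gcongr
    exact le_self_pow₀ (by linarith [Nat.cast_nonneg (α := ℝ) R.card]) two_ne_zero
  have hcut : ∀ A ∈ N.powerset.erase ∅, (1 - q) ^ (A.card * (insert w N \ A).card) =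
      (1 - q) ^ (A.card * (N.card + 1 - A.card)) := fun A hA => by
    have hAN := Finset.mem_powerset.1 (Finset.mem_of_mem_erase hA)
    rw [Finset.card_sdiff_of_subset (hAN.trans (Finset.subset_insert _ _)),
      Finset.card_insert_of_notMem fun h => hw (hN h)]
  rw [Finset.sum_congr rfl hcut]
  refine (sum_powerset_erase_one_sub_pow_le N hq0 hq1 (hmul.trans hle)).trans ?_
  gcongr

lemma sum_singleton_cut_le (hq0 : 0 ≤ q) (hq1 : q ≤ 1) (hw : w ∉ N)
    (hcard : 3 / 4 * (q * R.card) ≤ N.card) :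
    ∑ x ∈ R, (1 - q) ^ (insert w N \ {x}).card ≤
      R.card * Real.exp (-(3 / 8 * q ^ 2 * R.card)) := by
  have hle : ∀ x ∈ R, (1 - q) ^ (insert w N \ {x}).card ≤
      Real.exp (-(3 / 8 * q ^ 2 * R.card)) := fun x _ => by
    have hNx : N.card ≤ (insert w N \ {x}).card := by
      have h := Finset.le_card_sdiff {x} (insert w N)
      rwa [Finset.card_insert_of_notMem hw, Finset.card_singleton, Nat.add_sub_cancel] at h
    calc (1 - q) ^ (insert w N \ {x}).card ≤ (1 - q) ^ N.card :=
          pow_le_pow_of_le_one (by linarith) (by linarith) hNx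
      _ ≤ Real.exp (-(q * N.card)) := one_sub_pow_le_exp_neg_mul hq1 _
      _ ≤ _ := Real.exp_le_exp.2 (by
          nlinarith [mul_le_mul_of_nonneg_left hcard hq0,
            mul_nonneg (sq_nonneg q) (Nat.cast_nonneg (α := ℝ) R.card)])
  simpa using Finset.sum_le_card_nsmul R _ _ hle

end Cuts

lemma setBernoulli_univ_real_inNeighbors_eq_not_expands_le (q : I) {S N : Finset V} {w v : V}
    (hw : w ∈ S) (hv : v ∉ S) {t : ℕ} (ht : S.card = t + 1) (hN : N ⊆ S.erase w)
    (hcard : 3 / 4 * ((q : ℝ) * t) ≤ N.card)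
    (hε : (t + 1) ^ 2 * Real.exp (-(3 / 8 * (q : ℝ) ^ 2 * t)) ≤ 1) :
    (setBernoulli (Set.univ : Set (V × V)) q).real
      {η | inNeighbors η (S.erase w) v = N ∧ ¬ Expands η S w v} ≤
      q ^ N.card * (1 - q) ^ (t - N.card) *
        ((t + 1) ^ 2 * Real.exp (-(3 / 8 * (q : ℝ) ^ 2 * t))) := by
  set μ := setBernoulli (Set.univ : Set (V × V)) q
  set R := S.erase w with hR
  obtain rfl : R.card = t := by rw [hR, Finset.card_erase_of_mem hw, ht, Nat.add_sub_cancel]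
  have hwR : w ∉ R := Finset.notMem_erase w S
  have hvN : v ∉ insert w N := fun h =>
    hv (Finset.insert_subset hw (hN.trans (Finset.erase_subset _ _)) h)
  let cut : Finset V → Set (Set (V × V)) := fun A =>
    {η | inNeighbors η R v = N ∧ Disjoint (↑(A ×ˢ (insert w N \ A))) η}
  have hcut : ∀ A, μ.real (cut A) = q ^ N.card * (1 - q) ^ (R.card - N.card) *
      (1 - q) ^ (A.card * (insert w N \ A).card) := fun A =>
    setBernoulli_univ_real_inNeighbors_eq q hN (fun h => hvN (Finset.sdiff_subset h)) A
  have hsub : {η | inNeighbors η R v = N ∧ ¬ Expands η S w v} ⊆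
      (⋃ A ∈ N.powerset.erase ∅, cut A) ∪ ⋃ x ∈ R, cut {x} := by
    rintro η ⟨rfl, hη⟩
    obtain ⟨A, hA | ⟨x, hx, rfl⟩, hdisj⟩ := exists_disjoint_product_of_not_expands hw hη
    · exact .inl (Set.mem_biUnion hA ⟨rfl, hdisj⟩)
    · exact .inr (Set.mem_biUnion hx ⟨rfl, hdisj⟩)
  have hq0 : (0 : ℝ) ≤ q := q.2.1
  have hq1 : (0 : ℝ) ≤ 1 - q := sub_nonneg.2 q.2.2
  calc _ ≤ ∑ A ∈ N.powerset.erase ∅, μ.real (cut A) + ∑ x ∈ R, μ.real (cut {x}) :=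
        (measureReal_mono hsub (measure_ne_top _ _)).trans ((measureReal_union_le _ _).trans
          (add_le_add (measureReal_biUnion_finset_le _ _) (measureReal_biUnion_finset_le _ _)))
    _ = q ^ N.card * (1 - q) ^ (R.card - N.card) *
          (∑ A ∈ N.powerset.erase ∅, (1 - q : ℝ) ^ (A.card * (insert w N \ A).card) +
            ∑ x ∈ R, (1 - q : ℝ) ^ (insert w N \ {x}).card) := by
        simp only [hcut, ← Finset.mul_sum, mul_add, Finset.card_singleton, one_mul]
    _ ≤ _ := by
        gcongr
        have h₁ := sum_powerset_erase_cut_le hq0 q.2.2 hN hwR hcard hε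
        have h₂ := sum_singleton_cut_le (R := R) hq0 q.2.2 (fun h => hwR (hN h)) hcard
        have hpos := Real.exp_pos (-(3 / 8 * (q : ℝ) ^ 2 * R.card))
        nlinarith [Nat.cast_nonneg (α := ℝ) R.card]

lemma setBernoulli_univ_real_not_expands_le (q : I) {S : Finset V} {w v : V} (hw : w ∈ S)
    (hv : v ∉ S) {t : ℕ} (ht : S.card = t + 1) :
    (setBernoulli (Set.univ : Set (V × V)) q).real {η | ¬ Expands η S w v} ≤ absorbBound q t := by
  set μ := setBernoulli (Set.univ : Set (V × V)) q
  set R := S.erase w with hR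
  set ε := (t + 1) ^ 2 * Real.exp (-(3 / 8 * (q : ℝ) ^ 2 * t))
  have hq0 : (0 : ℝ) ≤ q := q.2.1
  have hq1 : (0 : ℝ) ≤ 1 - q := sub_nonneg.2 q.2.2
  rcases lt_or_ge 1 ε with hbig | hsmall
  · exact (measureReal_le_one.trans hbig.le).trans (le_add_of_nonneg_left (Real.exp_nonneg _))
  have hRt : R.card = t := by rw [hR, Finset.card_erase_of_mem hw, ht, Nat.add_sub_cancel]
  let many := R.powerset.filter fun N => 3 / 4 * ((q : ℝ) * R.card) ≤ N.card
  have hsub : {η | ¬ Expands η S w v} ⊆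
      {η | ((inNeighbors η R v).card : ℝ) < 3 / 4 * (q * R.card)} ∪
        ⋃ N ∈ many, {η | inNeighbors η R v = N ∧ ¬ Expands η S w v} := fun η hη =>
    (lt_or_ge ((inNeighbors η R v).card : ℝ) (3 / 4 * (q * R.card))).imp (fun h => h) fun h =>
      Set.mem_biUnion (Finset.mem_filter.2
        ⟨Finset.mem_powerset.2 (inNeighbors_subset η R v), h⟩) ⟨rfl, hη⟩
  have hmany : ∑ N ∈ many, μ.real {η | inNeighbors η R v = N ∧ ¬ Expands η S w v} ≤ ε := by
    calc _ ≤ ∑ N ∈ many, (q : ℝ) ^ N.card * (1 - q : ℝ) ^ (R.card - N.card) * ε := by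
          refine Finset.sum_le_sum fun N hN => ?_
          obtain ⟨hNR, hN⟩ := Finset.mem_filter.1 hN
          rw [hRt] at hN ⊢
          exact setBernoulli_univ_real_inNeighbors_eq_not_expands_le q hw hv ht
            (Finset.mem_powerset.1 hNR) hN hsmall
      _ ≤ ∑ N ∈ R.powerset, (q : ℝ) ^ N.card * (1 - q : ℝ) ^ (R.card - N.card) * ε :=
          Finset.sum_le_sum_of_subset_of_nonneg (Finset.filter_subset _ _)
            fun _ _ _ => by positivity
      _ = ε := by rw [← Finset.sum_mul, Finset.sum_pow_mul_eq_add_pow]; simp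
  refine (measureReal_mono hsub (measure_ne_top _ _)).trans ((measureReal_union_le _ _).trans
    (add_le_add ?_ ((measureReal_biUnion_finset_le _ _).trans hmany)))
  exact hRt ▸ setBernoulli_univ_real_card_inNeighbors_lt_le q R v

end Absorption

/-! ### Probability of saturation -/

section Sprinkling

lemma measureReal_prod_le_add {Ω Ω' : Type*} [MeasurableSpace Ω] [MeasurableSpace Ω']
    {μ : Measure Ω} {ν : Measure Ω'} [IsProbabilityMeasure μ] [IsProbabilityMeasure ν]
    {B : Set (Ω × Ω')} (hB : MeasurableSet B) {N : Set Ω} (hN : MeasurableSet N) {δ : ℝ}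
    (hδ : 0 ≤ δ) (h : ∀ ω ∉ N, ν.real (Prod.mk ω ⁻¹' B) ≤ δ) :
    (μ.prod ν).real B ≤ μ.real N + δ := by
  have hpoint : ∀ ω, ν (Prod.mk ω ⁻¹' B) ≤ N.indicator 1 ω + ENNReal.ofReal δ := fun ω => by
    by_cases hω : ω ∈ N
    · rw [Set.indicator_of_mem hω]
      exact prob_le_one.trans le_self_add
    · rw [Set.indicator_of_notMem hω, zero_add]
      exact (ENNReal.le_ofReal_iff_toReal_le (measure_ne_top _ _) hδ).2 (h ω hω)
  have hprod : (μ.prod ν) B ≤ μ N + ENNReal.ofReal δ :=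
    calc (μ.prod ν) B = ∫⁻ ω, ν (Prod.mk ω ⁻¹' B) ∂μ := Measure.prod_apply hB
      _ ≤ ∫⁻ ω, (N.indicator 1 ω + ENNReal.ofReal δ) ∂μ := lintegral_mono hpoint
      _ = μ N + ENNReal.ofReal δ := by
        rw [lintegral_add_right _ measurable_const, lintegral_indicator_one hN, lintegral_const,
          measure_univ, mul_one]
  calc (μ.prod ν).real B ≤ (μ N + ENNReal.ofReal δ).toReal := ENNReal.toReal_mono (by simp) hprod
    _ = μ.real N + δ := by
      rw [ENNReal.toReal_add (by simp) (by simp), ENNReal.toReal_ofReal hδ, measureReal_def]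

variable {V : Type*} {G : SimpleGraph V}

lemma setBernoulli_univ_real_not_absorbs_le [Finite V] [DecidableEq V] (q : I) {S : Finset V}
    {w v : V} (hw : w ∈ S) (hv : v ∉ S) {t : ℕ} (ht : S.card = t + 1) :
    (setBernoulli (Set.univ : Set (V × V)) q).real {η | ¬ Absorbs η S w v} ≤
      2 * absorbBound q t := by
  set μ := setBernoulli (Set.univ : Set (V × V)) q with hμ
  have hswap : μ.real {η | ¬ Expands (Prod.swap ⁻¹' η) S w v} = μ.real {η | ¬ Expands η S w v} := by
    conv_rhs => rw [hμ, ← Set.preimage_univ (f := Prod.swap),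
      ← map_preimage_setBernoulli Prod.swap_injective,
      map_measureReal_apply (measurable_of_countable _) MeasurableSet.of_discrete]
    rfl
  have hexp := setBernoulli_univ_real_not_expands_le q hw hv ht
  calc μ.real {η | ¬ Absorbs η S w v}
      ≤ μ.real ({η | ¬ Expands η S w v} ∪ {η | ¬ Expands (Prod.swap ⁻¹' η) S w v}) :=
        measureReal_mono fun η hη => not_and_or.1 hη
    _ ≤ absorbBound q t + absorbBound q t :=
        (measureReal_union_le _ _).trans (add_le_add hexp (hswap.trans_le hexp))
    _ = 2 * absorbBound q t := (two_mul _).symm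

variable [Fintype V]

lemma setBernoulli_univ_real_not_forall_absorbs_le [DecidableEq V] {S : ℕ → Finset V} {w v : ℕ → V}
    (h : IsGrowth G S w v) {k : ℕ} (hS : (S 0).card = k + 1) (q : I) :
    (setBernoulli (Set.univ : Set (V × V)) q).real
      {η | ¬ ∀ i, S i ≠ Finset.univ → Absorbs η (S i) (w i) (v i)} ≤
      ∑ t ∈ Finset.Ico k (Fintype.card V), 2 * absorbBound q t := by
  have hcard : ∀ i, S i ≠ Finset.univ →
      (S i).card = k + i + 1 ∧ k + i + 1 < Fintype.card V := fun i hi => by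
    have hlt := (Finset.card_lt_iff_ne_univ _).2 hi
    have hmin := h.card_eq_min i
    omega
  have hsub : {η | ¬ ∀ i, S i ≠ Finset.univ → Absorbs η (S i) (w i) (v i)} ⊆
      ⋃ i ∈ Finset.range (Fintype.card V - k),
        {η | S i ≠ Finset.univ ∧ ¬ Absorbs η (S i) (w i) (v i)} := fun η hη => by
    simp only [Set.mem_ofPred_eq, not_forall] at hη
    obtain ⟨i, hi, habs⟩ := hη
    have := (hcard i hi).2
    exact Set.mem_biUnion (Finset.mem_range.2 (by omega)) ⟨hi, habs⟩
  rw [Finset.sum_Ico_eq_sum_range]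
  refine (measureReal_mono hsub (measure_ne_top _ _)).trans
    ((measureReal_biUnion_finset_le _ _).trans (Finset.sum_le_sum fun i _ => ?_))
  by_cases hi : S i = Finset.univ
  · simpa [hi] using absorbBound_nonneg q (k + i)
  · obtain ⟨hw, hv, -⟩ := h.boundary i hi
    simpa [hi] using setBernoulli_univ_real_not_absorbs_le q hw hv (hcard i hi).1

/-- Once the edges of `ω` are open, the set `A` is saturated, whatever the other edges are. -/
def IsSeed (G : SimpleGraph V) (ω : Set (V × V)) (A : Finset V) : Prop :=
  ∀ η, ω ⊆ η → SaturatedOn η (eventuallyOccupied (edges G) (η ∩ eligible (edges G))) A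

lemma IsSeed.setBernoulli_univ_real_not_saturates_le {ω : Set (V × V)} {A : Finset V}
    (hω : IsSeed G ω A) (hG : G.Connected) {k : ℕ} (hA : A.card = k + 1) (q : I) :
    (setBernoulli (Set.univ : Set (V × V)) q).real
      {η | ¬ Saturates (edges G) ((ω ∪ η) ∩ eligible (edges G))} ≤
      ∑ t ∈ Finset.Ico k (Fintype.card V), 2 * absorbBound q t := by
  classical
  obtain ⟨S, w, v, rfl, hS⟩ := exists_isGrowth hG (A := A) (Finset.card_pos.1 (by omega))
  have hsub : {η | ¬ Saturates (edges G) ((ω ∪ η) ∩ eligible (edges G))} ⊆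
      {η | ¬ ∀ i, S i ≠ Finset.univ → Absorbs η (S i) (w i) (v i)} := fun η hη habs =>
    hη (saturates_of_saturatedOn_univ (hS.saturatedOn_univ (closedUnder_eventuallyOccupied _ _)
      Set.subset_union_right subset_eventuallyOccupied habs (hω _ Set.subset_union_left)))
  exact (measureReal_mono hsub (measure_ne_top _ _)).trans
    (setBernoulli_univ_real_not_forall_absorbs_le hS hA q)

lemma openLaw_real_not_saturates_le_add (hG : G.Connected) {p p₁ q : I}
    (hp : (1 - p : ℝ) = (1 - p₁) * (1 - q)) (k : ℕ) :
    (openLaw (edges G) p).real {Eopen | ¬ Saturates (edges G) Eopen} ≤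
      (setBernoulli (Set.univ : Set (V × V)) p₁).real
        {ω | ∀ A : Finset V, A.card = k + 1 → ¬ IsSeed G ω A} +
        ∑ t ∈ Finset.Ico k (Fintype.card V), 2 * absorbBound q t := by
  rw [openLaw, setBernoulli_eq_map_union_inter _ hp,
    map_measureReal_apply (measurable_of_countable _) MeasurableSet.of_discrete]
  refine measureReal_prod_le_add MeasurableSet.of_discrete MeasurableSet.of_discrete
    (Finset.sum_nonneg fun t _ => mul_nonneg zero_le_two (absorbBound_nonneg _ _)) fun ω hω => ?_
  simp only [Set.mem_ofPred_eq, not_forall, not_not] at hω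
  obtain ⟨A, hA, hseed⟩ := hω
  exact hseed.setBernoulli_univ_real_not_saturates_le hG hA q

end Sprinkling

section Seed

variable {V : Type*} {G : SimpleGraph V}

/-- The edges in both directions between `z` and the other vertices of `A`. -/
def doubleStar [DecidableEq V] (z : V) (A : Finset V) : Finset (V × V) :=
  {z} ×ˢ A.erase z ∪ A.erase z ×ˢ {z}

lemma card_doubleStar_le [DecidableEq V] {z : V} {A : Finset V} {k : ℕ} (hz : z ∈ A)
    (hA : A.card = k + 1) :
    (doubleStar z A).card ≤ 2 * k := by
  refine (Finset.card_union_le _ _).trans ?_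
  simp only [Finset.card_product, Finset.card_singleton, Finset.card_erase_of_mem hz, hA]
  omega

lemma fst_mem_of_mem_doubleStar [DecidableEq V] {z : V} {A : Finset V} (hz : z ∈ A) {e : V × V}
    (he : e ∈ doubleStar z A) : e.1 ∈ A := by
  rcases Finset.mem_union.1 he with he | he
  · exact Finset.mem_singleton.1 (Finset.mem_product.1 he).1 ▸ hz
  · exact Finset.mem_of_mem_erase (Finset.mem_product.1 he).1

lemma isSeed_of_doubleStar_subset [DecidableEq V] {ω : Set (V × V)} {A : Finset V}
    (hA : (G.induce (A : Set V)).Preconnected) {z : V} (hz : z ∈ A) (hω : ↑(doubleStar z A) ⊆ ω) :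
    IsSeed G ω A := fun η hη =>
  saturatedOn_of_open_star (closedUnder_eventuallyOccupied _ _) subset_eventuallyOccupied hA hz
    fun x hx hxz => ⟨hη (hω (by simp [doubleStar, hx, hxz])),
      hη (hω (by simp [doubleStar, hx, hxz]))⟩

lemma exists_isSeed_of_le_ncard_neighborSet [Finite V] {z : V} {k : ℕ}
    (hz : k ≤ (G.neighborSet z).ncard) (ω : Set (V × V)) :
    ∃ A : Finset V, A.card = k + 1 ∧ IsSeed G ω A := by
  classical
  have := Fintype.ofFinite V
  obtain ⟨B, hB, hcard⟩ := Finset.exists_subset_card_eq (s := G.neighborFinset z) (n := k) (by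
    rwa [← Set.ncard_coe_finset, SimpleGraph.coe_neighborFinset])
  have hzB : z ∉ B := fun h => G.irrefl ((G.mem_neighborFinset z z).1 (hB h))
  refine ⟨insert z B, by rw [Finset.card_insert_of_notMem hzB, hcard], fun η _ =>
    saturatedOn_of_star (closedUnder_eventuallyOccupied _ _) (z := z) fun x hx hxz => ?_⟩
  have hadj : G.Adj z x :=
    (G.mem_neighborFinset z x).1 (hB ((Finset.mem_insert.1 hx).resolve_left hxz))
  exact ⟨subset_eventuallyOccupied hadj, subset_eventuallyOccupied hadj.symm⟩

lemma prod_one_sub_pow_le_exp {J : Type*} [Fintype J] {p : ℝ} (hp0 : 0 ≤ p) (hp1 : p ≤ 1)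
    {m : J → ℕ} {M : ℕ} (hm : ∀ j, m j ≤ M) :
    ∏ j, (1 - p ^ m j) ≤ Real.exp (-(p ^ M * Fintype.card J)) :=
  calc ∏ j, (1 - p ^ m j) ≤ ∏ _j : J, Real.exp (-p ^ M) :=
        Finset.prod_le_prod (fun j _ => sub_nonneg.2 (pow_le_one₀ hp0 hp1)) fun j _ =>
          (sub_le_sub_left (pow_le_pow_of_le_one hp0 hp1 (hm j)) 1).trans
            (Real.one_sub_le_exp_neg _)
    _ = Real.exp (-(p ^ M * Fintype.card J)) := by
        rw [Finset.prod_const, ← Real.exp_nat_mul, Finset.card_univ]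
        ring_nf

lemma setBernoulli_univ_real_forall_not_isSeed_le_of_finset (p : I) {k : ℕ}
    {F : Finset (Finset V)}
    (hF : ∀ A ∈ F, A.card = k + 1 ∧ (G.induce (A : Set V)).Preconnected)
    (hdisj : (F : Set (Finset V)).PairwiseDisjoint id) :
    (setBernoulli (Set.univ : Set (V × V)) p).real
      {ω | ∀ A : Finset V, A.card = k + 1 → ¬ IsSeed G ω A} ≤
      Real.exp (-((p : ℝ) ^ (2 * k) * F.card)) := by
  classical
  have hne : ∀ A : F, ∃ z, z ∈ A.1 := fun A => Finset.card_pos.1 (by rw [(hF A A.2).1]; omega)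
  choose z hz using hne
  have hstar : Pairwise (Function.onFun Disjoint fun A : F => doubleStar (z A) A.1) :=
    fun A B hAB => Finset.disjoint_left.2 fun e heA heB =>
      Finset.disjoint_left.1 (hdisj A.2 B.2 (Subtype.coe_ne_coe.2 hAB))
        (fst_mem_of_mem_doubleStar (hz A) heA) (fst_mem_of_mem_doubleStar (hz B) heB)
  have hsub : {ω | ∀ A : Finset V, A.card = k + 1 → ¬ IsSeed G ω A} ⊆
      {ω | ∀ A : F, ¬ ↑(doubleStar (z A) A.1) ⊆ ω} := fun ω hω A hA =>
    hω A (hF A A.2).1 (isSeed_of_doubleStar_subset (hF A A.2).2 (hz A) hA)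
  calc _ ≤ (setBernoulli (Set.univ : Set (V × V)) p).real
        {ω | ∀ A : F, ¬ ↑(doubleStar (z A) A.1) ⊆ ω} :=
        measureReal_mono hsub (measure_ne_top _ _)
    _ = ∏ A : F, (1 - (p : ℝ) ^ (doubleStar (z A) A.1).card) :=
        setBernoulli_real_forall_not_superset p (fun _ => Set.subset_univ _) hstar
    _ ≤ _ := by
        simpa using prod_one_sub_pow_le_exp p.2.1 p.2.2
          fun A : F => card_doubleStar_le (hz A) (hF A A.2).1

variable [Fintype V]

lemma setBernoulli_univ_real_forall_not_isSeed_le (hG : G.Connected) (p : I) {k : ℕ}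
    (hk : k + 1 ≤ Fintype.card V) :
    (setBernoulli (Set.univ : Set (V × V)) p).real
      {ω | ∀ A : Finset V, A.card = k + 1 → ¬ IsSeed G ω A} ≤
      Real.exp (-((p : ℝ) ^ (2 * k) * (Fintype.card V / ((k + 1) * (1 + k * k))))) := by
  by_cases hdeg : ∀ v, (G.neighborSet v).ncard ≤ k
  · obtain ⟨F, hF, hdisj, hcard⟩ := exists_disjoint_preconnected hG hdeg hk
    refine (setBernoulli_univ_real_forall_not_isSeed_le_of_finset p hF hdisj).trans
      (Real.exp_le_exp.2 (neg_le_neg (mul_le_mul_of_nonneg_left ?_ (pow_nonneg p.2.1 _))))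
    rw [div_le_iff₀ (by positivity)]
    exact_mod_cast hcard
  · push Not at hdeg
    obtain ⟨z, hz⟩ := hdeg
    have hempty : {ω | ∀ A : Finset V, A.card = k + 1 → ¬ IsSeed G ω A} = ∅ :=
      Set.eq_empty_of_forall_notMem fun ω hω => by
        obtain ⟨A, hA, hseed⟩ := exists_isSeed_of_le_ncard_neighborSet hz.le ω
        exact hω A hA hseed
    rw [hempty, measureReal_empty]
    exact Real.exp_nonneg _

lemma openLaw_real_not_saturates_le (hG : G.Connected) {p p₁ q : I}
    (hp : (1 - p : ℝ) = (1 - p₁) * (1 - q)) {k : ℕ} (hk : k + 1 ≤ Fintype.card V) :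
    (openLaw (edges G) p).real {Eopen | ¬ Saturates (edges G) Eopen} ≤
      Real.exp (-((p₁ : ℝ) ^ (2 * k) * (Fintype.card V / ((k + 1) * (1 + k * k))))) +
        ∑ t ∈ Finset.Ico k (Fintype.card V), 2 * absorbBound q t :=
  (openLaw_real_not_saturates_le_add hG hp k).trans
    (add_le_add_left (setBernoulli_univ_real_forall_not_isSeed_le hG p₁ hk) _)

end Seed

/-! ### Supercritical asymptotics -/

section AbsorptionSum

lemma one_sub_exp_neg_ge {s : ℝ} (hs0 : 0 ≤ s) (hs1 : s ≤ 1) : s / 2 ≤ 1 - Real.exp (-s) := by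
  have hexp : Real.exp (-s) ≤ (1 + s)⁻¹ := by
    rw [Real.exp_neg]
    gcongr
    linarith [Real.add_one_le_exp s]
  have hinv : (1 + s)⁻¹ ≤ 1 - s / 2 := by
    rw [inv_le_iff_one_le_mul₀ (by linarith)]
    nlinarith
  linarith

lemma sum_Ico_exp_neg_mul_le {s : ℝ} (hs0 : 0 < s) (hs1 : s ≤ 1) (k n : ℕ) :
    ∑ t ∈ Finset.Ico k n, Real.exp (-(s * t)) ≤ 2 / s * Real.exp (-(s * k)) := by
  have hpow : ∀ t : ℕ, Real.exp (-(s * t)) = Real.exp (-s) ^ t := fun t => by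
    rw [← Real.exp_nat_mul]
    ring_nf
  have hgap := one_sub_exp_neg_ge hs0.le hs1
  simp only [hpow]
  calc ∑ t ∈ Finset.Ico k n, Real.exp (-s) ^ t
      ≤ Real.exp (-s) ^ k / (1 - Real.exp (-s)) :=
        geom_sum_Ico_le_of_lt_one (Real.exp_pos _).le (by linarith)
    _ ≤ Real.exp (-s) ^ k / (s / 2) := by gcongr
    _ = 2 / s * Real.exp (-s) ^ k := by field_simp

lemma add_one_sq_le_mul_exp {s t : ℝ} (hs0 : 0 < s) (hs : s ≤ 1 / 2) (ht : 0 ≤ t) :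
    (t + 1) ^ 2 ≤ 4 / s ^ 2 * Real.exp (s * t) := by
  have hexp_s : Real.exp s ≤ 2 :=
    (Real.le_log_iff_exp_le two_pos).1 (by linarith [Real.log_two_gt_d9])
  have hquad : (s * (t + 1)) ^ 2 / 2 ≤ Real.exp (s * (t + 1)) := by
    have h := Real.quadratic_le_exp_of_nonneg (show 0 ≤ s * (t + 1) by positivity)
    have : 0 ≤ s * (t + 1) := by positivity
    linarith
  have hsplit : Real.exp (s * (t + 1)) ≤ 2 * Real.exp (s * t) := by
    rw [mul_add_one, add_comm, Real.exp_add]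
    gcongr
  rw [div_mul_eq_mul_div, le_div_iff₀ (by positivity)]
  nlinarith

lemma two_mul_absorbBound_le {q : ℝ} (hq0 : 0 < q) (hq : q ≤ 1 / 15) (t : ℕ) :
    2 * absorbBound q t ≤ 9216 / q ^ 4 * Real.exp (-(q ^ 2 / 3 * t)) := by
  have hpoly := add_one_sq_le_mul_exp (s := q ^ 2 / 24) (by positivity) (by nlinarith)
    (Nat.cast_nonneg t)
  have hfirst : Real.exp (-(q * t / 40)) ≤ (t + 1) ^ 2 * Real.exp (-(3 / 8 * q ^ 2 * t)) :=
    calc Real.exp (-(q * t / 40)) ≤ Real.exp (-(3 / 8 * q ^ 2 * t)) := by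
          have : 0 ≤ q * t * (1 / 15 - q) := mul_nonneg (by positivity) (by linarith)
          exact Real.exp_le_exp.2 (by nlinarith)
      _ ≤ (t + 1) ^ 2 * Real.exp (-(3 / 8 * q ^ 2 * t)) :=
          le_mul_of_one_le_left (Real.exp_nonneg _) (one_le_pow₀ (by simp))
  calc 2 * absorbBound q t ≤ 4 * ((t + 1) ^ 2 * Real.exp (-(3 / 8 * q ^ 2 * t))) := by
        unfold absorbBound
        linarith
    _ ≤ 4 * (4 / (q ^ 2 / 24) ^ 2 * Real.exp (q ^ 2 / 24 * t) *
          Real.exp (-(3 / 8 * q ^ 2 * t))) := by gcongr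
    _ = 9216 / q ^ 4 * Real.exp (q ^ 2 / 24 * t + -(3 / 8 * q ^ 2 * t)) := by
        rw [Real.exp_add]
        field_simp
        norm_num
    _ = 9216 / q ^ 4 * Real.exp (-(q ^ 2 / 3 * t)) := by ring_nf

lemma sum_two_mul_absorbBound_le {q : ℝ} (hq0 : 0 < q) (hq : q ≤ 1 / 15) (k n : ℕ) :
    ∑ t ∈ Finset.Ico k n, 2 * absorbBound q t ≤
      55296 / q ^ 6 * Real.exp (-(q ^ 2 / 3 * k)) :=
  calc ∑ t ∈ Finset.Ico k n, 2 * absorbBound q t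
      ≤ 9216 / q ^ 4 * ∑ t ∈ Finset.Ico k n, Real.exp (-(q ^ 2 / 3 * t)) := by
        rw [Finset.mul_sum]
        exact Finset.sum_le_sum fun t _ => two_mul_absorbBound_le hq0 hq t
    _ ≤ 9216 / q ^ 4 * (2 / (q ^ 2 / 3) * Real.exp (-(q ^ 2 / 3 * k))) := by
        gcongr
        exact sum_Ico_exp_neg_mul_le (by positivity) (by nlinarith) k n
    _ = 55296 / q ^ 6 * Real.exp (-(q ^ 2 / 3 * k)) := by
        field_simp
        norm_num

end AbsorptionSum

section SupercriticalAsymptotics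

variable {l g : ℝ} {k : ℕ}

lemma sum_two_mul_absorbBound_le_exp (hl : l = Real.exp g) (hg : 1 ≤ g) {q : ℝ} (hq0 : 0 < q)
    (hq : q ≤ 1 / 15) (hql : q ^ 2 = 49 / 4 * g ^ 2 / l) (hk : 7 / 8 * l ≤ g * k) (n : ℕ) :
    ∑ t ∈ Finset.Ico k n, 2 * absorbBound q t ≤ 55296 * Real.exp (-(g / 2)) := by
  have hl0 : 0 < l := hl ▸ Real.exp_pos g
  have hexponent : 7 / 2 * g ≤ q ^ 2 / 3 * k :=
    calc 7 / 2 * g ≤ 49 / 12 * g / l * (7 / 8 * l) := by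
          field_simp
          linarith
      _ ≤ 49 / 12 * g / l * (g * k) := by gcongr
      _ = q ^ 2 / 3 * k := by
          rw [hql]
          ring
  have hfactor : 1 / q ^ 6 ≤ Real.exp (3 * g) :=
    calc 1 / q ^ 6 = (1 / q ^ 2) ^ 3 := by ring
      _ ≤ l ^ 3 := by
          gcongr
          rw [hql, one_div_div, div_le_iff₀ (by positivity)]
          exact le_mul_of_one_le_right hl0.le (by nlinarith)
      _ = Real.exp (3 * g) := by
          rw [hl, ← Real.exp_nat_mul]
          norm_num
  calc ∑ t ∈ Finset.Ico k n, 2 * absorbBound q t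
      ≤ 55296 * (1 / q ^ 6) * Real.exp (-(q ^ 2 / 3 * k)) := by
        simpa only [mul_one_div] using sum_two_mul_absorbBound_le hq0 hq k n
    _ ≤ 55296 * Real.exp (3 * g) * Real.exp (-(7 / 2 * g)) := by gcongr
    _ = 55296 * Real.exp (-(g / 2)) := by
        rw [mul_assoc, ← Real.exp_add]
        ring_nf

lemma exp_div_pow_four_le (hl : l = Real.exp g) (hk : g * k ≤ 7 / 8 * l + g) (hkl : k + 1 ≤ l)
    {p : ℝ} (hp : 1 / √l ≤ p) :
    Real.exp (l / 8) / l ^ 4 ≤ p ^ (2 * k) * (Real.exp l / ((k + 1) * (1 + k * k))) := by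
  have hl0 : 0 < l := hl ▸ Real.exp_pos g
  have hpow : Real.exp (-(7 / 8 * l + g)) ≤ p ^ (2 * k) :=
    calc Real.exp (-(7 / 8 * l + g)) ≤ Real.exp (-(g * k)) := Real.exp_le_exp.2 (by linarith)
      _ = (1 / √l) ^ (2 * k) := by
          rw [pow_mul, div_pow, Real.sq_sqrt hl0.le, hl, one_pow, one_div, ← Real.exp_neg,
            ← Real.exp_nat_mul]
          ring_nf
      _ ≤ p ^ (2 * k) := by gcongr
  have hpow0 : 0 ≤ p ^ (2 * k) := (Real.exp_nonneg _).trans hpow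
  have hdenom : ((k : ℝ) + 1) * (1 + k * k) ≤ l ^ 3 :=
    calc ((k : ℝ) + 1) * (1 + k * k) ≤ (k + 1) ^ 3 := by
          have : (0 : ℝ) ≤ k := Nat.cast_nonneg k
          nlinarith [mul_nonneg this this]
      _ ≤ l ^ 3 := by gcongr
  calc Real.exp (l / 8) / l ^ 4 = Real.exp (-(7 / 8 * l + g)) * (Real.exp l / l ^ 3) := by
        rw [neg_add, Real.exp_add, Real.exp_neg g, ← hl, show l / 8 = -(7 / 8 * l) + l by ring,
          Real.exp_add]
        field_simp
    _ ≤ p ^ (2 * k) * (Real.exp l / ((k + 1) * (1 + k * k))) := by gcongr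

lemma exists_nat_mul_mem_Icc (hg : 2 ≤ g) (hl : 4 ≤ l) :
    ∃ k : ℕ, 7 / 8 * l ≤ g * k ∧ g * k ≤ 7 / 8 * l + g ∧ k + 1 ≤ l := by
  have hg0 : 0 < g := by linarith
  have hquot : 7 / 8 * l / g ≤ 7 / 8 * l / 2 := by gcongr
  have hcancel : g * (7 / 8 * l / g) = 7 / 8 * l := mul_div_cancel₀ _ hg0.ne'
  have hceil : (⌈7 / 8 * l / g⌉₊ : ℝ) ≤ 7 / 8 * l / g + 1 :=
    (Nat.ceil_lt_add_one (by positivity)).le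
  refine ⟨⌈7 / 8 * l / g⌉₊, ?_, ?_, by linarith⟩
  · exact hcancel.symm.trans_le (by gcongr; exact Nat.le_ceil _)
  · nlinarith

lemma exists_one_sub_eq_mul {p q : I} (hqp : (q : ℝ) ≤ p) (hq : (q : ℝ) < 1) :
    ∃ p₁ : I, (1 - p : ℝ) = (1 - p₁) * (1 - q) ∧ (p - q : ℝ) ≤ p₁ := by
  have hq' : 0 < 1 - (q : ℝ) := sub_pos.2 hq
  have hpq : 0 ≤ (p - q : ℝ) := sub_nonneg.2 hqp
  refine ⟨⟨(p - q) / (1 - q), div_nonneg hpq hq'.le, ?_⟩, ?_, ?_⟩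
  · exact (div_le_one hq').2 (sub_le_sub_right p.2.2 _)
  · field_simp
    ring
  · exact le_div_self hpq hq' (sub_le_self _ q.2.1)

lemma openLaw_real_not_saturates_le_exp {V : Type*} [Fintype V] {G : SimpleGraph V}
    (hG : G.Connected) (hl : Real.exp l = Fintype.card V) (hg : l = Real.exp g)
    (hl4 : 4 ≤ l) (hg2 : 2 ≤ g) (hgl : g / √l ≤ 2 / 105) {p : I} (hp : 4 * (g / √l) ≤ p) :
    (openLaw (edges G) p).real {Eopen | ¬ Saturates (edges G) Eopen} ≤
      Real.exp (-(Real.exp (l / 8) / l ^ 4)) + 55296 * Real.exp (-(g / 2)) := by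
  have hsqrt : 0 < √l := Real.sqrt_pos.2 (by linarith)
  have hy0 : 0 < g / √l := div_pos (by linarith) hsqrt
  obtain ⟨k, hlk, hkl, hk⟩ := exists_nat_mul_mem_Icc hg2 hl4
  have hkV : k + 1 ≤ Fintype.card V := by
    have : (k + 1 : ℝ) ≤ Fintype.card V := by linarith [Real.add_one_le_exp l]
    exact_mod_cast this
  let q : I := ⟨7 / 2 * (g / √l), by linarith, by linarith⟩
  have hq : (q : ℝ) = 7 / 2 * (g / √l) := rfl
  have hqsq : (q : ℝ) ^ 2 = 49 / 4 * g ^ 2 / l := by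
    rw [hq, mul_pow, div_pow g, Real.sq_sqrt (by linarith)]
    ring
  obtain ⟨p₁, hprod, hp₁⟩ := exists_one_sub_eq_mul (p := p) (q := q) (by linarith) (by linarith)
  have hp₁l : 1 / √l ≤ p₁ :=
    calc 1 / √l ≤ (g / 2) / √l := by
          gcongr
          linarith
      _ = g / √l / 2 := div_right_comm _ _ _
      _ ≤ p₁ := by linarith
  refine (openLaw_real_not_saturates_le hG hprod hkV).trans (add_le_add ?_ ?_)
  · rw [← hl]
    exact Real.exp_le_exp.2 (neg_le_neg (exp_div_pow_four_le hg hkl hk hp₁l))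
  · exact sum_two_mul_absorbBound_le_exp hg (by linarith) (by linarith) (by linarith) hqsq hlk _

lemma tendsto_log_div_sqrt_atTop : Tendsto (fun x : ℝ => Real.log x / √x) atTop (𝓝 0) := by
  have h := (isLittleO_log_rpow_atTop (show (0 : ℝ) < 1 / 2 by norm_num)).tendsto_div_nhds_zero
  simpa only [Real.sqrt_eq_rpow] using h

lemma tendsto_exp_neg_exp_add_exp_neg_log :
    Tendsto (fun l : ℝ => Real.exp (-(Real.exp (l / 8) / l ^ 4)) +
      55296 * Real.exp (-(Real.log l / 2))) atTop (𝓝 0) := by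
  have hseed : Tendsto (fun l : ℝ => Real.exp (l / 8) / l ^ 4) atTop atTop :=
    (tendsto_exp_mul_div_rpow_atTop 4 (1 / 8) (by norm_num)).congr fun l => by
      norm_cast
      ring_nf
  have hsum := (Real.tendsto_exp_neg_atTop_nhds_zero.comp
    (Real.tendsto_log_atTop.atTop_div_const (two_pos (α := ℝ)))).const_mul 55296
  simpa using (Real.tendsto_exp_neg_atTop_nhds_zero.comp hseed).add hsum

theorem tendsto_probSaturated_one {C : ℝ} (hC : 4 ≤ C) {G : (n : ℕ) → SimpleGraph (Fin n)}
    {p : ℕ → I} (hG : ∀ᶠ n in atTop, (G n).Connected)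
    (hp : ∀ᶠ n : ℕ in atTop, C * (Real.log (Real.log n) / √(Real.log n)) ≤ (p n : ℝ)) :
    Tendsto (fun n : ℕ => probSaturated (edges (G n)) (p n)) atTop (𝓝 1) := by
  have hlog := tendsto_log_natCast_atTop
  have hreal : Tendsto (fun n : ℕ => (openLaw (edges (G n)) (p n)).real
      {Eopen | ¬ Saturates (edges (G n)) Eopen}) atTop (𝓝 0) := by
    refine squeeze_zero' (Eventually.of_forall fun n => measureReal_nonneg) ?_
      (tendsto_exp_neg_exp_add_exp_neg_log.comp hlog)
    filter_upwards [hG, hp, eventually_gt_atTop 0, hlog.eventually_ge_atTop 4,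
      (Real.tendsto_log_atTop.comp hlog).eventually_ge_atTop 2,
      (tendsto_log_div_sqrt_atTop.comp hlog).eventually_le_const
        (show (0 : ℝ) < 2 / 105 by norm_num)] with n hGn hpn hn hl4 hg2 hgl
    have hquot : 0 ≤ Real.log (Real.log n) / √(Real.log n) :=
      div_nonneg (zero_le_two.trans hg2) (Real.sqrt_nonneg _)
    refine openLaw_real_not_saturates_le_exp hGn ?_ (Real.exp_log (by linarith)).symm hl4 hg2 hgl
      ((mul_le_mul_of_nonneg_right hC hquot).trans hpn)
    rw [Real.exp_log (Nat.cast_pos.2 hn), Fintype.card_fin]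
  have hcompl := tendsto_measure_compl_one (fun n => .of_discrete)
    ((ENNReal.tendsto_toReal_iff (fun n => measure_ne_top _ _) ENNReal.zero_ne_top).1 hreal)
  simp only [Set.compl_ofPred, not_not] at hcompl
  exact hcompl

end SupercriticalAsymptotics

end TransClosure

open TransClosure in
theorem theorem1 :
    -- the basic theorem: connected unoriented initial graphs of bounded degree
    (∀ (D : ℕ) (α : ℝ), 0 < α → ∃ c C : ℝ, 0 < c ∧ 0 < C ∧
      ∀ (G : (n : ℕ) → SimpleGraph (Fin n)) (p : ℕ → I),
        (∀ᶠ n in atTop, (G n).Connected ∧ ∀ v, ((G n).neighborSet v).ncard ≤ D) →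
        ((∀ᶠ n : ℕ in atTop, (p n : ℝ) < c * (1 / √(Real.log n))) →
          Tendsto (fun n : ℕ => openLaw (edges (G n)) (p n)
              {Eopen | ¬ ∃ e ∈ eventuallyOccupied (edges (G n)) Eopen,
                ENNReal.ofReal (α * Real.log n) < (length (edges (G n)) e : ℝ≥0∞)})
            atTop (𝓝 1)) ∧
        ((∀ᶠ n : ℕ in atTop, C * (Real.log (Real.log n) / √(Real.log n)) < (p n : ℝ)) →
          Tendsto (fun n : ℕ => probSaturated (edges (G n)) (p n)) atTop (𝓝 1))) ∧
    -- stronger form of the first part: oriented initial graphs of bounded in- and out-degree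
    (∀ (D : ℕ) (α : ℝ), 0 < α → ∃ c : ℝ, 0 < c ∧
      ∀ (E0 : (n : ℕ) → Set (Fin n × Fin n)) (p : ℕ → I),
        (∀ᶠ n in atTop, ∀ v, (v, v) ∉ E0 n ∧
          {w | (v, w) ∈ E0 n}.ncard ≤ D ∧ {w | (w, v) ∈ E0 n}.ncard ≤ D) →
        (∀ᶠ n : ℕ in atTop, (p n : ℝ) < c / √(Real.log n)) →
        Tendsto (fun n : ℕ => openLaw (E0 n) (p n)
            {Eopen | ∃ e ∈ eventuallyOccupied (E0 n) Eopen,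
              ENNReal.ofReal (α * Real.log n) ≤ (length (E0 n) e : ℝ≥0∞)})
          atTop (𝓝 0)) ∧
    -- stronger form of the second part: any connected unoriented initial graph, any `C > 4`
    (∀ C : ℝ, 4 < C → ∀ (G : (n : ℕ) → SimpleGraph (Fin n)) (p : ℕ → I),
        (∀ᶠ n in atTop, (G n).Connected) →
        (∀ᶠ n : ℕ in atTop, C * Real.log (Real.log n) / √(Real.log n) ≤ (p n : ℝ)) →
        Tendsto (fun n : ℕ => probSaturated (edges (G n)) (p n)) atTop (𝓝 1)) := by
  refine ⟨fun D α hα => ?_, fun D α hα => ?_, fun C hC G p hG hp => ?_⟩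
  · obtain ⟨c, hc, hlong⟩ := exists_tendsto_not_exists_lt_length_one D hα
    refine ⟨c, 5, hc, by norm_num, fun G p hG => ⟨fun hp => ?_, fun hp => ?_⟩⟩
    · simp only [mul_one_div] at hp
      exact hlong G p (hG.mono fun n hn => hn.2) hp
    · exact tendsto_probSaturated_one (by norm_num) (hG.mono fun n hn => hn.1)
        (hp.mono fun n hn => hn.le)
  · obtain ⟨c, hc, hlong⟩ := exists_tendsto_exists_le_length_zero D hα
    exact ⟨c, hc, fun E0 p hE0 => hlong E0 p (hE0.mono fun n hn =>
      ⟨fun v => (hn v).1, fun v => (hn v).2.1, fun v => (hn v).2.2⟩)⟩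
  · simp only [mul_div_assoc] at hp
    exact tendsto_probSaturated_one hC.le hG hp
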